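/- Let $d,n\ge 1$. For an integrable function $f:\mathbb{R}^d\to[0,\infty)$ with $\int f>0$ let $$[\mathrm{Cov}(f)]_{ij}=\frac{\int x_ix_jf}{\int f}-\frac{\int x_if\,\int x_jf}{(\int f)^2},\qquad \sigma_f:=\det(\mathrm{Cov}(f))^{1/(2d)},$$ and for $K\ge 0$ call $f$ almost isotropic with constant $K$ if $|\mathrm{Cov}(f)_{ii}-\sigma_f^2|\le K\sigma_f$ for all $i$ and $|\mathrm{Cov}(f)_{ij}|\le K\sigma_f$ for all $i\ne j$. A function $f:\mathbb{R}^d\to[0,\infty)$ is a log-concave extension of $p:\mathbb{Z}^d\to[0,1]$ if $f=e^{-V}$ with $V:\mathbb{R}^d\to\mathbb{R}\cup\{+\infty\}$ convex, and $f(k)=p(k)$ for all $k\in\mathbb{Z}^d$. There is a constant $C=C(d,n)>0$ such that for every $K$ there is $N=N(d,n,K)$ with the following property. Let $X_1,\dots,X_n$ be i.i.d. random vectors on $\mathbb{Z}^d$ such that the probability mass function of $S_n=X_1+\cdots+X_n$ has a log-concave extension $f$ which is almost isotropic with constant $K$ and has $\sigma_f\ge N$. Let $U_1,\dots,U_n$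 be i.i.d. uniform on $[0,1]^d$, independent of $X_1,\dots,X_n$. Then the Shannon entropies $H(X_1)$ and $H(S_n)$ (natural logarithms) and the differential entropy $h(S_n+U_1+\cdots+U_n)$ are well defined and finite, and $$\bigl|h(S_n+U_1+\cdots+U_n)-H(S_n)\bigr|\le C\,H(X_1)\,e^{-H(X_1)/d}.$$ Moreover, with $\sigma:=\det(\mathrm{Cov}(X_1))^{1/(2d)}$, $$\bigl|h(S_n+U_1+\cdots+U_n)-H(S_n)\bigr|\le C\,\frac{\log\sigma}{\sigma}.$$ In particular the difference tends to $0$ as $H(X_1)\to\infty$ within this regime. -/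

import Mathlib

open MeasureTheory ProbabilityTheory

noncomputable section

namespace DiscreteEntropy

/-- `f = exp (-V)` for a convex function `V : ℝ^d → ℝ ∪ {+∞}`. The set `D` is the effective domain
`{V < +∞}`, so that `f` vanishes off `D`; `ConvexOn` contains the convexity of `D`. -/
def IsLogConcave {d : ℕ} (f : (Fin d → ℝ) → ℝ) : Prop :=
  ∃ (D : Set (Fin d → ℝ)) (V : (Fin d → ℝ) → ℝ),
    ConvexOn ℝ D V ∧ f = D.indicator fun x => Real.exp (-V x)

/-- `f` is a log-concave extension to `ℝ^d` of the function `p` on `ℤ^d`. -/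
def IsLogConcaveExtension {d : ℕ} (p : (Fin d → ℤ) → ℝ) (f : (Fin d → ℝ) → ℝ) : Prop :=
  IsLogConcave f ∧ ∀ k : Fin d → ℤ, f (fun i => (k i : ℝ)) = p k

/-- The covariance matrix of a nonnegative function on `ℝ^d`. -/
def covMatrix {d : ℕ} (f : (Fin d → ℝ) → ℝ) : Matrix (Fin d) (Fin d) ℝ :=
  Matrix.of fun i j =>
    (∫ x, x i * x j * f x) / (∫ x, f x) -
      ((∫ x, x i * f x) * (∫ x, x j * f x)) / (∫ x, f x) ^ 2

/-- The covariance matrix of a nonnegative function on `ℤ^d`. -/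
def discreteCovMatrix {d : ℕ} (p : (Fin d → ℤ) → ℝ) : Matrix (Fin d) (Fin d) ℝ :=
  Matrix.of fun i j =>
    (∑' k : Fin d → ℤ, (k i : ℝ) * (k j : ℝ) * p k) / (∑' k, p k) -
      ((∑' k : Fin d → ℤ, (k i : ℝ) * p k) * (∑' k : Fin d → ℤ, (k j : ℝ) * p k)) /
        (∑' k, p k) ^ 2

/-- The parameter `σ = det(A)^(1/(2d))` of a `d × d` covariance matrix `A`. -/
def scale {d : ℕ} (A : Matrix (Fin d) (Fin d) ℝ) : ℝ :=
  A.det ^ (1 / (2 * (d : ℝ)))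

/-- Almost isotropy with implied constant `K`: with `σ = det(Cov f)^(1/(2d))`, the diagonal entries
of `Cov f` are within `K σ` of `σ ^ 2` and the other entries are within `K σ` of `0`. -/
structure IsAlmostIsotropic {d : ℕ} (K : ℝ) (f : (Fin d → ℝ) → ℝ) : Prop where
  integrable : Integrable f
  diag : ∀ i, |covMatrix f i i - scale (covMatrix f) ^ 2| ≤ K * scale (covMatrix f)
  offDiag : ∀ i j, i ≠ j → |covMatrix f i j| ≤ K * scale (covMatrix f)

/-- The probability mass function of a random vector `X` on `ℤ^d`. -/
def pmf {Ω : Type*} [MeasurableSpace Ω] {d : ℕ} (P : Measure Ω) (X : Ω → Fin d → ℤ) :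
    (Fin d → ℤ) → ℝ :=
  fun k => (P.map X).real {k}

/-- The Shannon entropy `-∑ p log p` (natural logarithm) of a random vector on `ℤ^d`. -/
def shannonEntropy {Ω : Type*} [MeasurableSpace Ω] {d : ℕ} (P : Measure Ω)
    (X : Ω → Fin d → ℤ) : ℝ :=
  ∑' k, Real.negMulLog (pmf P X k)

/-- The series defining the Shannon entropy converges. -/
def HasShannonEntropy {Ω : Type*} [MeasurableSpace Ω] {d : ℕ} (P : Measure Ω)
    (X : Ω → Fin d → ℤ) : Prop :=
  Summable fun k => Real.negMulLog (pmf P X k)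

/-- The differential entropy `-∫ g log g` of a random vector in `ℝ^d` with Lebesgue density `g`. -/
def differentialEntropy {Ω : Type*} [MeasurableSpace Ω] {d : ℕ} (P : Measure Ω)
    (Y : Ω → Fin d → ℝ) : ℝ :=
  ∫ x, Real.negMulLog (pdf Y P volume x).toReal

/-- `Y` has a Lebesgue density, and the integral defining its differential entropy converges. -/
def HasDifferentialEntropy {Ω : Type*} [MeasurableSpace Ω] {d : ℕ} (P : Measure Ω)
    (Y : Ω → Fin d → ℝ) : Prop :=
  HasPDF Y P volume ∧ Integrable fun x => Real.negMulLog (pdf Y P volume x).toReal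

/-- The sum `X₁ + ⋯ + Xₙ`. -/
def latticeSum {Ω : Type*} {d n : ℕ} (X : Fin n → Ω → Fin d → ℤ) : Ω → Fin d → ℤ :=
  fun ω => ∑ i, X i ω

/-- The sum `X₁ + ⋯ + Xₙ + U₁ + ⋯ + Uₙ`, as a random vector in `ℝ^d`. -/
def smoothedSum {Ω : Type*} {d n : ℕ} (X : Fin n → Ω → Fin d → ℤ) (U : Fin n → Ω → Fin d → ℝ) :
    Ω → Fin d → ℝ :=
  fun ω j => (latticeSum X ω j : ℝ) + ∑ i, U i ω j

end DiscreteEntropy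

end

/-! Write `p` for the mass function of `S_n` and `s = σ_f`. The core is the bound `0 ≤ h - H(S_n) ≤
G / s` with `G = G(d, n)`. Both stated rates follow from it, because `exp (-H(X₁)/d)` is at least a
constant times `1/s` and `H(X₁) ≥ 1`, while `σ` is of the order of `s` and `log σ ≥ 1`.

Gap. The density of the smoothed sum is `g(x) = ∑ p(k) u(x - k)`, where `u` is the density of `U₁ +
⋯ + Uₙ`. The integer translates of `u` sum to one, so `g(x)` is a convex combination of the values
of `p` at no more than `(n+1)^d` lattice points near `x`. Concavity of `-t log t` gives `h ≥ H`; the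
Jensen gap at `x` is controlled by the oscillation of those values, with no logarithmic loss
(`negMulLog_sum_le`). After integration (`entropy_smoothing`) only the variations `∑ |p(k + e_i) -
p(k)|` remain.

Variation. On a lattice line `p` is unimodal, so its variation there is at most a multiple of its
supremum. With `p(k) ≤ A s^(-d) ∏ exp(-b |k_i - c_i| / s)`, summing over the `(d-1)`-dimensional
family of parallel lines leaves `O(1/s)` (`shiftVariation_single_le`).

Decay (`IsSpread.exists_decay`). For `s ≥ 2Kd` the matrix `Cov f` is comparable to `s² I`; `K`
enters only through this threshold, so `C` does not depend on it. By log-concavity, `{f ≥ f(z)/4}`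
must then be wide in every direction and contains a cube of side of order `s`. Since `f` sums to one
over the lattice, `f = O(s^(-d))`. The second moment confines such cubes, at near-maximal height, to
distance `O(s)` from one point, so `f` drops by a fixed factor at distance `O(s)` and log-concavity
turns the drop into exponential decay.

Comparison of `s` with `X₁`. Decay bounds the variances of `S_n` from above, and bounds them from
below because a thin slab carries at most half the mass; division by `n` passes to `X₁`, so `σ` is
of order `s`. Gibbs' inequality gives `H(X₁) ≤ d log s + O(1)`, and `P(X₁ = k)^n ≤ p(nk)` makes the
atoms small, so `H(X₁) ≥ 1`. -/

namespace DiscreteEntropy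

/-! ### Log-concave functions: geometric decay and second moments. -/

section LogConcave

variable {d : ℕ} {f : (Fin d → ℝ) → ℝ}

theorem IsLogConcave.nonneg (hf : IsLogConcave f) (x : Fin d → ℝ) : 0 ≤ f x := by
  obtain ⟨D, V, -, rfl⟩ := hf
  exact Set.indicator_nonneg (fun _ _ => (Real.exp_pos _).le) x

theorem IsLogConcave.rpow_mul_rpow_le (hf : IsLogConcave f) {x y : Fin d → ℝ} (hx : 0 < f x)
    (hy : 0 < f y) {a b : ℝ} (ha : 0 ≤ a) (hb : 0 ≤ b) (hab : a + b = 1) :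
    f x ^ a * f y ^ b ≤ f (a • x + b • y) := by
  obtain ⟨D, V, hV, rfl⟩ := hf
  have hxD : x ∈ D := by
    by_contra h
    simp [h] at hx
  have hyD : y ∈ D := by
    by_contra h
    simp [h] at hy
  have hz := hV.1 hxD hyD ha hb hab
  simp only [Set.indicator_of_mem hxD, Set.indicator_of_mem hyD, Set.indicator_of_mem hz]
  rw [← Real.exp_mul, ← Real.exp_mul, ← Real.exp_add, Real.exp_le_exp]
  have := hV.2 hxD hyD ha hb hab
  simp only [smul_eq_mul] at this
  linarith

theorem IsLogConcave.convex_superlevel (hf : IsLogConcave f) {t : ℝ} (ht : 0 < t) :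
    Convex ℝ {x | t ≤ f x} := by
  intro x hx y hy a b ha hb hab
  simp only [Set.mem_ofPred_eq] at *
  refine le_trans ?_ (hf.rpow_mul_rpow_le (ht.trans_le hx) (ht.trans_le hy) ha hb hab)
  calc t = t ^ a * t ^ b := by rw [← Real.rpow_add ht, hab, Real.rpow_one]
    _ ≤ f x ^ a * f y ^ b :=
        mul_le_mul (Real.rpow_le_rpow ht.le hx ha) (Real.rpow_le_rpow ht.le hy hb) (by positivity)
          (Real.rpow_nonneg (hf.nonneg x) a)

theorem IsLogConcave.mul_le_sq_midpoint (hf : IsLogConcave f) (x y : Fin d → ℝ) :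
    f x * f y ≤ f ((1 / 2 : ℝ) • x + (1 / 2 : ℝ) • y) ^ 2 := by
  rcases (hf.nonneg x).eq_or_lt with hx | hx
  · rw [← hx, zero_mul]; positivity
  rcases (hf.nonneg y).eq_or_lt with hy | hy
  · rw [← hy, mul_zero]; positivity
  have h := hf.rpow_mul_rpow_le hx hy (a := 1 / 2) (b := 1 / 2) (by norm_num) (by norm_num)
    (by norm_num)
  calc f x * f y = (f x ^ (1 / 2 : ℝ) * f y ^ (1 / 2 : ℝ)) ^ 2 := by
        rw [mul_pow, ← Real.sqrt_eq_rpow, ← Real.sqrt_eq_rpow, Real.sq_sqrt hx.le,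
          Real.sq_sqrt hy.le]
    _ ≤ _ := by gcongr

/-- If `f` has dropped by the factor `κ` on the way from `z` to `x`, then it decays geometrically
beyond that point. -/
theorem IsLogConcave.le_mul_rpow (hf : IsLogConcave f) {z x : Fin d → ℝ} (hz : 0 < f z) {κ t : ℝ}
    (hκ : 0 ≤ κ) (ht : 1 ≤ t) (h : f (z + t⁻¹ • (x - z)) ≤ f z * κ) : f x ≤ f z * κ ^ t := by
  rcases (hf.nonneg x).eq_or_lt with hx | hx
  · rw [← hx]; positivity
  have ht0 : 0 < t := by linarith
  have hti : t⁻¹ ≤ 1 := inv_le_one_of_one_le₀ ht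
  have h1 := hf.rpow_mul_rpow_le hx hz (a := t⁻¹) (b := 1 - t⁻¹) (by positivity) (by linarith)
    (by ring)
  have h2 : t⁻¹ • x + (1 - t⁻¹) • z = z + t⁻¹ • (x - z) := by
    rw [smul_sub, sub_smul, one_smul]; abel
  rw [h2] at h1
  have h3 : (f x / f z) ^ t⁻¹ ≤ κ := by
    have h4 : f x ^ t⁻¹ * f z ^ (1 - t⁻¹) = (f x / f z) ^ t⁻¹ * f z := by
      rw [Real.rpow_sub hz, Real.div_rpow hx.le hz.le, Real.rpow_one]
      ring
    rw [h4] at h1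
    have := h1.trans h
    rw [mul_comm] at this
    exact le_of_mul_le_mul_left this hz
  have h5 : f x / f z ≤ κ ^ t := by
    calc f x / f z = ((f x / f z) ^ t⁻¹) ^ t := by
          rw [← Real.rpow_mul (by positivity), inv_mul_cancel₀ ht0.ne', Real.rpow_one]
      _ ≤ κ ^ t := by gcongr
  rw [div_le_iff₀ hz] at h5
  linarith

/-- If `f` drops by a factor `4` outside the `w`-ball of a seminorm `N` around `z`, then the weight
`N ^ 2` costs at most a factor of order `w ^ 2`. -/
theorem IsLogConcave.sq_mul_le (hf : IsLogConcave f) {z : Fin d → ℝ} (hz : 0 < f z)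
    (N : (Fin d → ℝ) → ℝ) (hN0 : ∀ x, 0 ≤ N x) (hN : ∀ (a : ℝ) x, 0 ≤ a → N (a • x) = a * N x)
    {w : ℝ} (hw : 0 < w) (h : ∀ y, w ≤ N (y - z) → f y ≤ f z / 4) (x : Fin d → ℝ) :
    N (x - z) ^ 2 * f x ≤ 4 * w ^ 2 * (f x + f ((1 / 2 : ℝ) • x + (1 / 2 : ℝ) • z)) := by
  have hx0 := hf.nonneg x
  set y := (1 / 2 : ℝ) • x + (1 / 2 : ℝ) • z with hy
  have hy0 := hf.nonneg y
  rcases le_or_gt (N (x - z)) (2 * w) with hle | hgt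
  · have h1 : N (x - z) ^ 2 ≤ 4 * w ^ 2 := by
      have := pow_le_pow_left₀ (hN0 (x - z)) hle 2
      linarith
    nlinarith [mul_le_mul_of_nonneg_right h1 hx0, mul_nonneg (sq_nonneg w) hy0]
  · set u := N (x - z) / (2 * w) with hu
    have hu1 : 1 ≤ u := by rw [hu, le_div_iff₀ (by positivity)]; linarith
    have hu0 : 0 < u := by linarith
    have hyz : y - z = (1 / 2 : ℝ) • (x - z) := by
      rw [hy, smul_sub]
      have : z = (1 / 2 : ℝ) • z + (1 / 2 : ℝ) • z := by rw [← add_smul]; norm_num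
      nth_rewrite 2 [this]
      abel
    -- The midpoint `y` is at `N`-distance `w * u` from `z`, so the drop by `4` at distance `w` is
    -- raised to the power `u`. Midpoint log-concavity then gives `f x / f y ≤ f y / f z`, and `u ≤
    -- 2 ^ u` lets the factor `4 ^ (-u)` absorb `u ^ 2`.
    have h1 : f y ≤ f z * (1 / 4) ^ u := by
      apply hf.le_mul_rpow hz (by norm_num) hu1
      have := h (z + u⁻¹ • (y - z)) (by
        rw [add_sub_cancel_left, hN _ _ (by positivity), hyz, hN _ _ (by norm_num), hu]
        have : N (x - z) ≠ 0 := by linarith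
        field_simp
        norm_num)
      linarith
    have h2 : f x * f z ≤ f y ^ 2 := hf.mul_le_sq_midpoint x z
    have h3 : f x ≤ f y * (1 / 4) ^ u := by
      have : f x * f z ≤ (f y * (1 / 4) ^ u) * f z := by nlinarith
      exact le_of_mul_le_mul_right this hz
    have h4 : u ^ 2 * (1 / 4 : ℝ) ^ u ≤ 1 := by
      have h5 : u ≤ (2 : ℝ) ^ u := by
        have := one_add_mul_self_le_rpow_one_add (s := 1) (by norm_num) hu1
        norm_num at this
        linarith
      have h6 : (1 / 4 : ℝ) ^ u = (((2 : ℝ) ^ u) ^ 2)⁻¹ := by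
        rw [one_div, Real.inv_rpow (by norm_num), ← Real.rpow_natCast, ← Real.rpow_mul (by norm_num),
          mul_comm, Real.rpow_mul (by norm_num)]
        norm_num
      rw [h6, ← div_eq_mul_inv, div_le_one (by positivity)]
      gcongr
    have h7 : N (x - z) = 2 * w * u := by rw [hu]; field_simp
    rw [h7]
    calc (2 * w * u) ^ 2 * f x ≤ (2 * w * u) ^ 2 * (f y * (1 / 4) ^ u) := by gcongr
      _ = 4 * w ^ 2 * f y * (u ^ 2 * (1 / 4 : ℝ) ^ u) := by ring
      _ ≤ 4 * w ^ 2 * f y * 1 := by gcongr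
      _ ≤ _ := by nlinarith [mul_nonneg (sq_nonneg w) hx0]

/-- If `f ≥ t` on a ball and at a point `x`, then `f ≥ t` on the ball contracted halfway towards `x`. -/
theorem IsLogConcave.le_on_midpoint_ball (hf : IsLogConcave f) {t : ℝ} (ht : 0 < t)
    {z x : Fin d → ℝ} {ε : ℝ} (hball : ∀ y, ‖y - z‖ ≤ ε → t ≤ f y) (hx : t ≤ f x)
    {y : Fin d → ℝ} (hy : ‖y - ((1 / 2 : ℝ) • x + (1 / 2 : ℝ) • z)‖ ≤ ε / 2) : t ≤ f y := by
  set y' := z + (2 : ℝ) • (y - ((1 / 2 : ℝ) • x + (1 / 2 : ℝ) • z)) with hy'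
  have h1 : t ≤ f y' := hball _ (by
    rw [hy', add_sub_cancel_left, norm_smul]
    norm_num
    linarith)
  have h2 := hf.convex_superlevel ht hx h1 (a := 1 / 2) (b := 1 / 2) (by norm_num) (by norm_num)
    (by norm_num)
  have h3 : (1 / 2 : ℝ) • x + (1 / 2 : ℝ) • y' = y := by
    ext i
    simp only [hy', Pi.add_apply, Pi.smul_apply, Pi.sub_apply, smul_eq_mul]
    ring
  rw [h3] at h2
  exact h2

/-- An integrable log-concave function with positive integral is bounded below on some ball. -/
theorem IsLogConcave.exists_ball (hf : IsLogConcave f) (hpos : 0 < ∫ x, f x) :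
    ∃ (z : Fin d → ℝ) (ε δ : ℝ), 0 < ε ∧ 0 < δ ∧ ∀ y, ‖y - z‖ ≤ ε → δ ≤ f y := by
  obtain ⟨D, V, hV, hfD⟩ := id hf
  -- A convex set without interior lies in the closure of its null frontier, which would make `f`
  -- vanish almost everywhere.
  have hintg : (interior D).Nonempty := by
    by_contra hne
    rw [Set.not_nonempty_iff_eq_empty] at hne
    have h0 : volume D = 0 := by
      refine measure_mono_null ?_ (hV.1.addHaar_frontier volume)
      rw [frontier, hne, Set.sdiff_empty]
      exact subset_closure
    have : ∫ x, f x = 0 := by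
      apply integral_eq_zero_of_ae
      have : ∀ᵐ x, x ∉ D := by simpa [ae_iff] using h0
      filter_upwards [this] with x hx
      simp [hfD, hx]
    linarith
  obtain ⟨z, hz⟩ := hintg
  have hcont : ContinuousAt V z :=
    hV.continuousOn_interior.continuousAt (isOpen_interior.mem_nhds hz)
  have h1 : ∀ᶠ y in nhds z, V y < V z + 1 := hcont.eventually_lt_const (by linarith)
  have h2 : ∀ᶠ y in nhds z, y ∈ D := mem_interior_iff_mem_nhds.1 hz
  obtain ⟨ε, hε, hball⟩ := Metric.eventually_nhds_iff.1 (h1.and h2)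
  refine ⟨z, ε / 2, Real.exp (-(V z + 1)), by positivity, Real.exp_pos _, fun y hy => ?_⟩
  obtain ⟨h3, h4⟩ := hball (y := y) (by rw [dist_eq_norm]; linarith)
  rw [hfD, Set.indicator_of_mem h4, Real.exp_le_exp]
  linarith

/-- A far point of the superlevel set, joined to a fixed ball where `f ≥ δ`, produces a ball of
fixed radius around the midpoint where `f ≥ min δ t`. That ball is also far out and carries a fixed
mass `v`, contradicting the vanishing of the tail integrals. -/
theorem IsLogConcave.superlevel_bounded (hf : IsLogConcave f) (hi : Integrable f)
    (hpos : 0 < ∫ x, f x) {t : ℝ} (ht : 0 < t) : ∃ R, ∀ x, t ≤ f x → ‖x‖ ≤ R := by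
  obtain ⟨z, ε, δ, hε, hδ, hball⟩ := hf.exists_ball hpos
  set τ := min δ t with hτ
  have hτ0 : 0 < τ := lt_min hδ ht
  have hanti : Antitone fun n : ℕ => {x : Fin d → ℝ | (n : ℝ) ≤ ‖x‖} := by
    intro a b hab x hx
    have : (a : ℝ) ≤ b := by exact_mod_cast hab
    exact this.trans hx
  have htend := tendsto_setIntegral_of_antitone (μ := volume) (f := f)
    (s := fun n : ℕ => {x : Fin d → ℝ | (n : ℝ) ≤ ‖x‖})
    (fun n => (isClosed_le continuous_const continuous_norm).measurableSet) hanti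
    ⟨0, hi.integrableOn⟩
  have hempty : ⋂ n : ℕ, {x : Fin d → ℝ | (n : ℝ) ≤ ‖x‖} = ∅ := by
    ext x
    simp only [Set.mem_iInter, Set.mem_ofPred_eq, Set.mem_empty_iff_false, iff_false, not_forall,
      not_le]
    exact exists_nat_gt _
  rw [hempty, setIntegral_empty] at htend
  set v := τ * (volume (Metric.closedBall (0 : Fin d → ℝ) (ε / 2))).toReal with hv
  have hv0 : 0 < v := mul_pos hτ0 (ENNReal.toReal_pos
    (Metric.measure_closedBall_pos volume _ (by positivity)).ne' measure_closedBall_lt_top.ne)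
  obtain ⟨n, hn⟩ := (htend.eventually_lt_const hv0).exists
  -- Beyond this radius the midpoint of `x` and `z` has norm at least `n + ε / 2`, so its `ε /
  -- 2`-ball avoids the region `‖y‖ < n`.
  refine ⟨2 * (n + ε / 2) + ‖z‖, fun x hx => ?_⟩
  by_contra! hlt
  set c := (1 / 2 : ℝ) • x + (1 / 2 : ℝ) • z with hc
  have hcn : n + ε / 2 ≤ ‖c‖ := by
    have h1 : ‖x‖ ≤ 2 * ‖c‖ + ‖z‖ := by
      have : x = (2 : ℝ) • c - z := by
        ext i; simp only [hc, Pi.sub_apply, Pi.smul_apply, Pi.add_apply, smul_eq_mul]; ring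
      calc ‖x‖ = ‖(2 : ℝ) • c - z‖ := by rw [← this]
        _ ≤ ‖(2 : ℝ) • c‖ + ‖z‖ := norm_sub_le _ _
        _ = _ := by rw [norm_smul]; norm_num
    linarith
  have hsub : Metric.closedBall c (ε / 2) ⊆ {x | (n : ℝ) ≤ ‖x‖} := by
    intro y hy
    rw [mem_closedBall_iff_norm] at hy
    have := norm_sub_norm_le c y
    rw [norm_sub_rev] at this
    simp only [Set.mem_ofPred_eq]
    linarith
  have hlow : ∀ y ∈ Metric.closedBall c (ε / 2), τ ≤ f y := fun y hy =>
    hf.le_on_midpoint_ball hτ0 (fun y hy => (min_le_left _ _).trans (hball y hy))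
      ((min_le_right _ _).trans hx) (mem_closedBall_iff_norm.1 hy)
  have h1 : v ≤ ∫ y in Metric.closedBall c (ε / 2), f y := by
    have := setIntegral_ge_of_const_le_real (μ := volume) (f := f) (c := τ)
      Metric.isClosed_closedBall.measurableSet
      measure_closedBall_lt_top.ne hlow hi.integrableOn
    rw [hv]
    convert this using 2
    rw [measureReal_def, ← Measure.addHaar_closedBall_center volume c]
  have h2 : ∫ y in Metric.closedBall c (ε / 2), f y ≤ ∫ y in {x | (n : ℝ) ≤ ‖x‖}, f y :=
    setIntegral_mono_set hi.integrableOn (Filter.Eventually.of_forall fun y => hf.nonneg y)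
      hsub.eventuallyLE
  linarith

theorem integrable_comp_midpoint (hi : Integrable f) (z : Fin d → ℝ) :
    Integrable fun x => f ((1 / 2 : ℝ) • x + (1 / 2 : ℝ) • z) := by
  have h := (hi.comp_add_right ((1 / 2 : ℝ) • z))
  exact h.comp_smul (by norm_num : (1 / 2 : ℝ) ≠ 0)

theorem integral_comp_midpoint (z : Fin d → ℝ) :
    ∫ x, f ((1 / 2 : ℝ) • x + (1 / 2 : ℝ) • z) = 2 ^ d * ∫ x, f x := by
  have h := Measure.integral_comp_smul volume (fun x => f (x + (1 / 2 : ℝ) • z)) (1 / 2)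
  rw [h, integral_add_right_eq_self]
  simp

/-- Bounded superlevel sets provide the width needed in `sq_mul_le`, which dominates the weighted
function by `f` and its dilation about `z`. -/
theorem IsLogConcave.integrable_norm_sq_mul (hf : IsLogConcave f) (hi : Integrable f)
    (hpos : 0 < ∫ x, f x) : Integrable fun x => ‖x‖ ^ 2 * f x := by
  obtain ⟨z, ε, δ, hε, hδ, hball⟩ := hf.exists_ball hpos
  have hz : 0 < f z := hδ.trans_le (hball z (by simpa using hε.le))
  obtain ⟨R, hR⟩ := hf.superlevel_bounded hi hpos (t := f z / 4) (by positivity)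
  have hR0 : 0 ≤ R := (norm_nonneg z).trans (hR z (by linarith))
  have key := hf.sq_mul_le hz (fun x => ‖x‖) (fun x => norm_nonneg x)
    (fun a x ha => by rw [norm_smul, Real.norm_of_nonneg ha]) (w := R + ‖z‖ + 1) (by positivity)
    (fun y hy => by
      by_contra! hlt
      have := hR y hlt.le
      have := norm_sub_le y z
      linarith)
  have hg : Integrable fun x => 2 * (4 * (R + ‖z‖ + 1) ^ 2 *
      (f x + f ((1 / 2 : ℝ) • x + (1 / 2 : ℝ) • z))) + 2 * (‖z‖ ^ 2 * f x) :=
    (((hi.add (integrable_comp_midpoint hi z)).const_mul _).const_mul _).add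
      ((hi.const_mul _).const_mul _)
  refine hg.mono' ((continuous_norm.pow 2).aestronglyMeasurable.mul hi.1)
    (Filter.Eventually.of_forall fun x => ?_)
  have hx0 := hf.nonneg x
  rw [Real.norm_of_nonneg (by positivity)]
  have h1 : ‖x‖ ^ 2 ≤ 2 * ‖x - z‖ ^ 2 + 2 * ‖z‖ ^ 2 := by
    have h2 : ‖x‖ ≤ ‖x - z‖ + ‖z‖ := by simpa using norm_add_le (x - z) z
    nlinarith [sq_nonneg (‖x - z‖ - ‖z‖), norm_nonneg x, norm_nonneg (x - z), norm_nonneg z]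
  nlinarith [key x, mul_le_mul_of_nonneg_right h1 hx0]

end LogConcave

/-! ### Cubes inside convex sets that are wide in all directions. -/

section Cube

open Matrix

variable {d : ℕ}

/-- A bounded set which meets every hyperplane complement contains `d` vectors of almost maximal
determinant. -/
theorem exists_almost_max_det (S : Set (Fin d → ℝ)) {R : ℝ} (hR : ∀ y ∈ S, ‖y‖ ≤ R)
    (h : ∀ θ : Fin d → ℝ, θ ≠ 0 → ∃ y ∈ S, θ ⬝ᵥ y ≠ 0) :
    ∃ v : Matrix (Fin d) (Fin d) ℝ, (∀ j, v j ∈ S) ∧ v.det ≠ 0 ∧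
      ∀ u : Matrix (Fin d) (Fin d) ℝ, (∀ j, u j ∈ S) → |u.det| ≤ 2 * |v.det| := by
  have hspan : Submodule.span ℝ S = ⊤ := by
    by_contra hne
    obtain ⟨φ, hφ, hker⟩ := Submodule.exists_le_ker_of_lt_top _ (lt_top_iff_ne_top.2 hne)
    set θ : Fin d → ℝ := fun i => φ fun j => if i = j then 1 else 0 with hθ
    have happ : ∀ y, φ y = θ ⬝ᵥ y := fun y => by
      rw [LinearMap.pi_apply_eq_sum_univ φ y]
      simp [dotProduct, hθ, mul_comm]
    have hθ0 : θ ≠ 0 := by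
      intro h0
      apply hφ
      ext1 i
      ext
      simp [happ, h0]
    obtain ⟨y, hy, hne'⟩ := h θ hθ0
    exact hne' (by rw [← happ]; exact hker (Submodule.subset_span hy))
  obtain ⟨v₀, hv₀, hdet₀⟩ : ∃ v : Matrix (Fin d) (Fin d) ℝ, (∀ j, v j ∈ S) ∧ v.det ≠ 0 := by
    obtain ⟨g, hg, -, hli⟩ := Submodule.exists_fun_fin_finrank_span_eq ℝ S
    have hfin : Module.finrank ℝ (Submodule.span ℝ S) = d := by
      rw [hspan, finrank_top]; simp
    refine ⟨Matrix.of fun j => g (Fin.cast hfin.symm j), fun j => hg _, ?_⟩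
    have h1 : LinearIndependent ℝ (Matrix.of fun j => g (Fin.cast hfin.symm j)).row :=
      hli.comp _ (Fin.cast_injective _)
    rw [Matrix.linearIndependent_rows_iff_isUnit, Matrix.isUnit_iff_isUnit_det] at h1
    exact h1.ne_zero
  set T : Set ℝ := {t | ∃ v : Matrix (Fin d) (Fin d) ℝ, (∀ j, v j ∈ S) ∧ |v.det| = t} with hT
  have hbdd : BddAbove T := by
    refine ⟨(Fintype.card (Fin d)).factorial • R ^ Fintype.card (Fin d), ?_⟩
    rintro t ⟨v, hv, rfl⟩
    exact Matrix.det_le (abv := AbsoluteValue.abs) fun i j =>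
      (norm_le_pi_norm (v i) j).trans (hR _ (hv i))
  have hpos : 0 < sSup T :=
    (abs_pos.2 hdet₀).trans_le (le_csSup hbdd ⟨v₀, hv₀, rfl⟩)
  -- `S` need not be closed, so the supremum may not be attained; settling for half of it costs the
  -- factor `2`.
  obtain ⟨t, ⟨v, hv, rfl⟩, hlt⟩ := exists_lt_of_lt_csSup (s := T) ⟨_, v₀, hv₀, rfl⟩
    (show sSup T / 2 < sSup T by linarith)
  refine ⟨v, hv, fun h0 => ?_, fun u hu => ?_⟩
  · rw [h0, abs_zero] at hlt
    linarith
  · have := le_csSup hbdd (show |u.det| ∈ T from ⟨u, hu, rfl⟩)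
    linarith

/-- A bounded convex set which is wide in every direction contains a large cube. -/
theorem exists_cube_subset_of_wide (hd : 0 < d) {L : Set (Fin d → ℝ)} (hL : Convex ℝ L) {R : ℝ}
    (hR : ∀ x ∈ L, ‖x‖ ≤ R) {z : Fin d → ℝ} (hz : z ∈ L) {w : ℝ} (hw : 0 < w)
    (h : ∀ θ : Fin d → ℝ, θ ≠ 0 → ∃ x ∈ L, w * ‖θ‖ ≤ |θ ⬝ᵥ (x - z)|) :
    ∃ c, ∀ y, ‖y - c‖ ≤ w / (4 * d ^ 2) → y ∈ L := by
  have hd' : (0 : ℝ) < d := by exact_mod_cast hd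
  obtain ⟨v, hv, hdet, hmax⟩ := exists_almost_max_det {y | z + y ∈ L} (R := R + ‖z‖)
    (fun y hy => by
      have h1 := hR _ hy
      have h2 : ‖y‖ ≤ ‖z + y‖ + ‖z‖ := by simpa using norm_sub_le (z + y) z
      linarith)
    (fun θ hθ => by
      obtain ⟨x, hx, hle⟩ := h θ hθ
      refine ⟨x - z, by simpa using hx, fun h0 => ?_⟩
      rw [h0, abs_zero] at hle
      have : 0 < w * ‖θ‖ := mul_pos hw (norm_pos_iff.2 hθ)
      linarith)
  have hunit : IsUnit v.det := hdet.isUnit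
  -- Cramer's rule: each coordinate of `x - z` in the basis `v` is a ratio of determinants, at most
  -- `2` by near-maximality.
  have hcoef : ∀ x ∈ L, ∀ j, |((x - z) ᵥ* v⁻¹) j| ≤ 2 := by
    intro x hx j
    have h1 : vᵀ *ᵥ (vᵀ.cramer (x - z)) = v.det • (x - z) := by
      rw [Matrix.mulVec_cramer, Matrix.det_transpose]
    rw [Matrix.mulVec_transpose] at h1
    have h2 : vᵀ.cramer (x - z) = v.det • ((x - z) ᵥ* v⁻¹) := by
      rw [← Matrix.smul_vecMul, ← h1, Matrix.vecMul_vecMul, Matrix.mul_nonsing_inv v hunit,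
        Matrix.vecMul_one]
    have h3 := congrFun h2 j
    rw [Matrix.cramer_transpose_apply, Pi.smul_apply, smul_eq_mul] at h3
    have h4 := hmax (v.updateRow j (x - z)) (fun i => by
      by_cases hij : i = j
      · subst hij
        simpa using hx
      · rw [Matrix.updateRow_ne hij]
        exact hv i)
    rw [h3, abs_mul, mul_comm] at h4
    exact le_of_mul_le_mul_right h4 (abs_pos.2 hdet)
  -- The coordinate functionals are bounded by `2` on `L - z`; width in their own directions forces
  -- the functionals to be small.
  have hcol : ∀ j : Fin d, w * ‖fun i : Fin d => v⁻¹ i j‖ ≤ 2 := by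
    intro j
    by_cases h0 : (fun i => v⁻¹ i j) = 0
    · rw [h0, norm_zero]; norm_num
    obtain ⟨x, hx, hle⟩ := h _ h0
    refine hle.trans ?_
    rw [dotProduct_comm]
    exact hcoef x hx j
  -- An interior point of the simplex with vertices `z` and `z + v j`, with weight `1 / (2 * d)` on
  -- each `z + v j`. A perturbation changing these weights by at most `1 / (2 * d)` keeps them in
  -- `[0, 1 / d]`, so it stays inside the simplex.
  refine ⟨z + ∑ j, (1 / (2 * d) : ℝ) • v j, fun y hy => ?_⟩
  set u := y - (z + ∑ j, (1 / (2 * d) : ℝ) • v j) with hu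
  set b := u ᵥ* v⁻¹ with hb
  have hbv : ∑ j, b j • v j = u := by
    have : b ᵥ* v = u := by
      rw [hb, Matrix.vecMul_vecMul, Matrix.nonsing_inv_mul v hunit, Matrix.vecMul_one]
    rw [← this, Matrix.vecMul_eq_sum]
  have hbsmall : ∀ j, |b j| ≤ 1 / (2 * d) := by
    intro j
    have h1 : |b j| ≤ ∑ _i : Fin d, ‖u‖ * ‖fun i : Fin d => v⁻¹ i j‖ := by
      rw [hb, Matrix.vecMul, dotProduct]
      refine (Finset.abs_sum_le_sum_abs _ _).trans (Finset.sum_le_sum fun i _ => ?_)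
      rw [abs_mul]
      exact mul_le_mul (norm_le_pi_norm u i) (norm_le_pi_norm (fun i => v⁻¹ i j) i) (abs_nonneg _)
        (norm_nonneg _)
    rw [Finset.sum_const, Finset.card_univ, Fintype.card_fin, nsmul_eq_mul] at h1
    have h2 : ‖fun i => v⁻¹ i j‖ ≤ 2 / w := by
      rw [le_div_iff₀ hw]; linarith [hcol j]
    calc |b j| ≤ d * (‖u‖ * ‖fun i => v⁻¹ i j‖) := h1
      _ ≤ d * (w / (4 * d ^ 2) * (2 / w)) := by gcongr
      _ = 1 / (2 * d) := by field_simp; norm_num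
  have hy' : y = ∑ o : Option (Fin d), (Option.elim o (1 - ∑ j, (1 / (2 * d) + b j))
      fun j => (1 / (2 * d) + b j)) • (Option.elim o z fun j => z + v j) := by
    rw [Fintype.sum_option]
    simp only [Option.elim]
    have : y = z + ∑ j, (1 / (2 * d) : ℝ) • v j + ∑ j, b j • v j := by
      rw [hbv, hu]; abel
    rw [this, sub_smul, one_smul, Finset.sum_smul]
    simp only [smul_add, add_smul, Finset.sum_add_distrib]
    abel
  rw [hy']
  refine hL.sum_mem ?_ ?_ ?_
  · rintro (_ | j) -
    · simp only [Option.elim]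
      have : ∑ j, (1 / (2 * d) + b j) ≤ ∑ _j : Fin d, (1 / d : ℝ) := by
        refine Finset.sum_le_sum fun j _ => ?_
        have := (abs_le.1 (hbsmall j)).2
        have h2 : (1 / d : ℝ) = 1 / (2 * d) + 1 / (2 * d) := by field_simp; norm_num
        linarith
      rw [Finset.sum_const, Finset.card_univ, Fintype.card_fin, nsmul_eq_mul,
        mul_one_div_cancel hd'.ne'] at this
      linarith
    · simp only [Option.elim]
      have := (abs_le.1 (hbsmall j)).1
      linarith
  · rw [Fintype.sum_option]
    simp
  · rintro (_ | j) -
    · exact hz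
    · exact hv j

end Cube

/-! ### Second moments of affine functionals. -/

section Moments

variable {d : ℕ} {f : (Fin d → ℝ) → ℝ}

theorem IsLogConcave.integrable_coord_mul_coord_mul (hf : IsLogConcave f) (hi : Integrable f)
    (hpos : 0 < ∫ x, f x) (i j : Fin d) : Integrable fun x => x i * x j * f x := by
  refine (hf.integrable_norm_sq_mul hi hpos).mono'
    (((continuous_apply i).mul (continuous_apply j)).aestronglyMeasurable.mul hi.1)
    (Filter.Eventually.of_forall fun x => ?_)
  rw [norm_mul, norm_mul, Real.norm_of_nonneg (hf.nonneg x), sq]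
  exact mul_le_mul_of_nonneg_right (mul_le_mul (norm_le_pi_norm x i) (norm_le_pi_norm x j)
    (norm_nonneg _) (norm_nonneg _)) (hf.nonneg x)

theorem IsLogConcave.integrable_coord_mul (hf : IsLogConcave f) (hi : Integrable f)
    (hpos : 0 < ∫ x, f x) (i : Fin d) : Integrable fun x => x i * f x := by
  refine ((hf.integrable_norm_sq_mul hi hpos).add hi).mono'
    ((continuous_apply i).aestronglyMeasurable.mul hi.1)
    (Filter.Eventually.of_forall fun x => ?_)
  have h0 := hf.nonneg x
  rw [norm_mul, Real.norm_of_nonneg h0, Pi.add_apply]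
  have h1 : ‖x i‖ ≤ ‖x‖ ^ 2 + 1 := by
    have := norm_le_pi_norm x i
    nlinarith [sq_nonneg (‖x‖ - 1)]
  nlinarith [mul_le_mul_of_nonneg_right h1 h0]

/-- Variance plus squared bias of the linear form `θ`, for the unnormalised weight `f`. -/
theorem IsLogConcave.integrable_affine_sq_mul (hf : IsLogConcave f) (hi : Integrable f)
    (hpos : 0 < ∫ x, f x) (θ : Fin d → ℝ) (a : ℝ) :
    Integrable (fun x => (∑ i, θ i * x i - a) ^ 2 * f x) ∧
    ∫ x, (∑ i, θ i * x i - a) ^ 2 * f x =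
      (∫ x, f x) * (∑ i, ∑ j, θ i * θ j * covMatrix f i j) +
        (∑ i, θ i * (∫ x, x i * f x) - a * ∫ x, f x) ^ 2 / ∫ x, f x := by
  have hexp : ∀ x, (∑ i, θ i * x i - a) ^ 2 * f x =
      (∑ i, ∑ j, θ i * θ j * (x i * x j * f x)) - (2 * a) * (∑ i, θ i * (x i * f x)) +
        a ^ 2 * f x := by
    intro x
    have h1 : ∑ i, ∑ j, θ i * θ j * (x i * x j * f x) = (∑ i, θ i * x i) ^ 2 * f x := by
      rw [sq, Finset.sum_mul_sum, Finset.sum_mul]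
      refine Finset.sum_congr rfl fun i _ => ?_
      rw [Finset.sum_mul]
      exact Finset.sum_congr rfl fun j _ => by ring
    have h2 : ∑ i, θ i * (x i * f x) = (∑ i, θ i * x i) * f x := by
      rw [Finset.sum_mul]
      exact Finset.sum_congr rfl fun j _ => by ring
    rw [h1, h2]; ring
  have hI2 : ∀ i j, Integrable fun x => θ i * θ j * (x i * x j * f x) := fun i j =>
    (hf.integrable_coord_mul_coord_mul hi hpos i j).const_mul _
  have hI1 : ∀ i, Integrable fun x => θ i * (x i * f x) := fun i =>
    (hf.integrable_coord_mul hi hpos i).const_mul _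
  have hS2 : Integrable fun x => ∑ i, ∑ j, θ i * θ j * (x i * x j * f x) :=
    integrable_finsetSum _ fun i _ => integrable_finsetSum _ fun j _ => hI2 i j
  have hS1 : Integrable fun x => (2 * a) * ∑ i, θ i * (x i * f x) :=
    (integrable_finsetSum _ fun i _ => hI1 i).const_mul _
  have hS0 : Integrable fun x => a ^ 2 * f x := hi.const_mul _
  have hS : Integrable fun x => (∑ i, ∑ j, θ i * θ j * (x i * x j * f x)) -
      (2 * a) * ∑ i, θ i * (x i * f x) := hS2.sub hS1
  simp_rw [hexp]
  refine ⟨hS.add hS0, ?_⟩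
  rw [integral_add hS hS0, integral_sub hS2 hS1, integral_const_mul,
    integral_const_mul, integral_finsetSum _ fun i _ => hI1 i,
    integral_finsetSum _ fun i _ => integrable_finsetSum _ fun j _ => hI2 i j]
  simp_rw [fun i => integral_finsetSum Finset.univ fun j _ => hI2 i j, integral_const_mul]
  simp only [covMatrix, Matrix.of_apply]
  set I := ∫ x, f x
  have hcov : ∑ i, ∑ j, θ i * θ j * ((∫ x, x i * x j * f x) / I -
      (∫ x, x i * f x) * (∫ x, x j * f x) / I ^ 2) =
      (∑ i, ∑ j, θ i * θ j * ∫ x, x i * x j * f x) / I - (∑ i, θ i * ∫ x, x i * f x) ^ 2 / I ^ 2 := by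
    rw [sq (∑ i, _), Finset.sum_mul_sum, Finset.sum_div, Finset.sum_div, ← Finset.sum_sub_distrib]
    refine Finset.sum_congr rfl fun i _ => ?_
    rw [Finset.sum_div, Finset.sum_div, ← Finset.sum_sub_distrib]
    exact Finset.sum_congr rfl fun j _ => by ring
  rw [hcov]
  have := hpos.ne'
  field_simp
  ring

end Moments

/-! ### From a covariance of order `s ^ 2` to exponential decay on the scale `s`. -/

section Decay

variable {d : ℕ} {f : (Fin d → ℝ) → ℝ} {s : ℝ}

theorem norm_sq_le_sum_sq (x : Fin d → ℝ) : ‖x‖ ^ 2 ≤ ∑ i, x i ^ 2 := by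
  have h0 : 0 ≤ ∑ i, x i ^ 2 := Finset.sum_nonneg fun i _ => sq_nonneg _
  have h1 : ‖x‖ ≤ √(∑ i, x i ^ 2) := by
    rw [pi_norm_le_iff_of_nonneg (Real.sqrt_nonneg _)]
    intro i
    exact Real.abs_le_sqrt (Finset.single_le_sum (f := fun i => x i ^ 2)
      (fun i _ => sq_nonneg _) (Finset.mem_univ i))
  calc ‖x‖ ^ 2 ≤ √(∑ i, x i ^ 2) ^ 2 := by gcongr
    _ = _ := Real.sq_sqrt h0

/-- `f` is an integrable log-concave function whose covariance matrix is of the order of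
`s ^ 2` times the identity. -/
structure IsSpread (s : ℝ) (f : (Fin d → ℝ) → ℝ) : Prop where
  pos : 0 < s
  logConcave : IsLogConcave f
  integrable : Integrable f
  integral_pos : 0 < ∫ x, f x
  lower : ∀ θ : Fin d → ℝ, s ^ 2 / 2 * ∑ i, θ i ^ 2 ≤ ∑ i, ∑ j, θ i * θ j * covMatrix f i j
  upper : ∀ i, covMatrix f i i ≤ 2 * s ^ 2

/-- If the superlevel set lay in a thin slab around `z`, then `sq_mul_le` would bound the second
moment of `θ` about `z` by `4 * w ^ 2 * (1 + 2 ^ d) * ∫ f`, where `2 ^ d` comes from dilating about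
`z`. The choice of `w` puts this below the lower bound given by the variance. -/
theorem IsSpread.exists_wide (hf : IsSpread s f) {z : Fin d → ℝ} (hz : 0 < f z) {θ : Fin d → ℝ}
    (hθ : θ ≠ 0) :
    ∃ x, f z / 4 ≤ f x ∧ s / (4 * (1 + 2 ^ d)) * ‖θ‖ ≤ |∑ i, θ i * (x - z) i| := by
  by_contra! hcon
  set w := s / (4 * (1 + 2 ^ d)) * ‖θ‖ with hw
  have hθ0 : 0 < ‖θ‖ := norm_pos_iff.2 hθ
  have hs := hf.pos
  have hw0 : 0 < w := by positivity
  have hI := hf.integral_pos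
  obtain ⟨hintg, hval⟩ := hf.logConcave.integrable_affine_sq_mul hf.integrable hI θ (∑ i, θ i * z i)
  have hpt : ∀ x, (∑ i, θ i * x i - ∑ i, θ i * z i) ^ 2 * f x ≤
      4 * w ^ 2 * (f x + f ((1 / 2 : ℝ) • x + (1 / 2 : ℝ) • z)) := by
    intro x
    have := hf.logConcave.sq_mul_le hz (fun x => |∑ i, θ i * x i|) (fun x => abs_nonneg _)
      (fun a x ha => by
        simp only [Pi.smul_apply, smul_eq_mul]
        rw [← abs_of_nonneg ha, ← abs_mul, Finset.mul_sum, abs_of_nonneg ha]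
        congr 1
        exact Finset.sum_congr rfl fun i _ => by ring) hw0
      (fun y hy => by
        by_contra! hlt
        exact absurd hy (not_le.2 (hcon y hlt.le))) x
    rw [sq_abs] at this
    convert this using 3
    rw [← Finset.sum_sub_distrib]
    exact Finset.sum_congr rfl fun i _ => by rw [Pi.sub_apply]; ring
  have hle := integral_mono hintg
    ((hf.integrable.add (integrable_comp_midpoint hf.integrable z)).const_mul (4 * w ^ 2)) hpt
  simp only [Pi.add_apply] at hle
  rw [integral_const_mul, integral_add hf.integrable (integrable_comp_midpoint hf.integrable z),
    integral_comp_midpoint, hval] at hle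
  set I := ∫ x, f x
  have h1 : I * (s ^ 2 / 2 * ‖θ‖ ^ 2) ≤ 4 * w ^ 2 * (I + 2 ^ d * I) := by
    have hn : ‖θ‖ ^ 2 ≤ ∑ i, θ i ^ 2 := norm_sq_le_sum_sq θ
    have h2 : s ^ 2 / 2 * ‖θ‖ ^ 2 ≤ ∑ i, ∑ j, θ i * θ j * covMatrix f i j :=
      le_trans (by gcongr) (hf.lower θ)
    have h3 : 0 ≤ (∑ i, θ i * (∫ x, x i * f x) - (∑ i, θ i * z i) * I) ^ 2 / I := by positivity
    nlinarith [mul_le_mul_of_nonneg_left h2 hI.le]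
  have h4 : s ^ 2 / 2 * ‖θ‖ ^ 2 ≤ 4 * w ^ 2 * (1 + 2 ^ d) := by
    refine le_of_mul_le_mul_left ?_ hI
    linarith
  rw [hw] at h4
  have h5 : 4 * (s / (4 * (1 + 2 ^ d)) * ‖θ‖) ^ 2 * (1 + 2 ^ d) =
      s ^ 2 * ‖θ‖ ^ 2 / (4 * (1 + 2 ^ d)) := by field_simp
  rw [h5, le_div_iff₀ (by positivity)] at h4
  have h6 : (1 : ℝ) ≤ 2 ^ d := one_le_pow₀ (by norm_num)
  have h7 : 0 < s ^ 2 * ‖θ‖ ^ 2 := by positivity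
  nlinarith

theorem IsSpread.exists_cube (hd : 0 < d) (hf : IsSpread s f) {z : Fin d → ℝ} (hz : 0 < f z) :
    ∃ c, ∀ y, ‖y - c‖ ≤ 1 / (16 * d ^ 2 * (1 + 2 ^ d)) * s → f z / 4 ≤ f y := by
  obtain ⟨R, hR⟩ := hf.logConcave.superlevel_bounded hf.integrable hf.integral_pos
    (t := f z / 4) (by positivity)
  have hs := hf.pos
  obtain ⟨c, hc⟩ := exists_cube_subset_of_wide hd
    (hf.logConcave.convex_superlevel (t := f z / 4) (by positivity)) hR
    (z := z) (show f z / 4 ≤ f z by linarith) (w := s / (4 * (1 + 2 ^ d))) (by positivity)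
    (fun θ hθ => hf.exists_wide hz hθ)
  refine ⟨c, fun y hy => hc y (hy.trans_eq ?_)⟩
  have : (0 : ℝ) < d := by exact_mod_cast hd
  field_simp
  norm_num

/-- Each coordinate interval of length `2 * h` contains at least `2 * h - 1 ≥ h` integers. -/
theorem exists_finset_int_cube (c : Fin d → ℝ) {h : ℝ} (hh : 1 ≤ h) :
    ∃ F : Finset (Fin d → ℤ), h ^ d ≤ F.card ∧ ∀ k ∈ F, ‖(fun i => (k i : ℝ)) - c‖ ≤ h := by
  refine ⟨Fintype.piFinset fun i => Finset.Icc ⌈c i - h⌉ ⌊c i + h⌋, ?_, fun k hk => ?_⟩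
  · rw [Fintype.card_piFinset]
    push_cast
    have hcard : h ^ d = ∏ _i : Fin d, h := by simp
    rw [hcard]
    refine Finset.prod_le_prod (fun i _ => by linarith) fun i _ => ?_
    rw [Int.card_Icc]
    have h1 := Int.lt_floor_add_one (c i + h)
    have h2 := Int.ceil_lt_add_one (c i - h)
    have h3 : h ≤ ((⌊c i + h⌋ + 1 - ⌈c i - h⌉ : ℤ) : ℝ) := by push_cast; linarith
    exact h3.trans (by exact_mod_cast Int.self_le_toNat _)
  · rw [pi_norm_le_iff_of_nonneg (by linarith)]
    intro i
    have := Fintype.mem_piFinset.1 hk i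
    rw [Finset.mem_Icc, Int.ceil_le, Int.le_floor] at this
    rw [Pi.sub_apply, Real.norm_eq_abs, abs_le]
    constructor <;> linarith [this.1, this.2]

/-- The value at `z` persists up to a factor `4` on a cube with at least `h ^ d` lattice points,
whose total is at most one. -/
theorem IsSpread.le_of_sum_le (hd : 0 < d) (hf : IsSpread s f)
    (hsum : ∀ F : Finset (Fin d → ℤ), ∑ k ∈ F, f (fun i => (k i : ℝ)) ≤ 1)
    (hs : 1 ≤ 1 / (16 * d ^ 2 * (1 + 2 ^ d)) * s) (z : Fin d → ℝ) :
    f z ≤ 4 / (1 / (16 * d ^ 2 * (1 + 2 ^ d)) * s) ^ d := by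
  set h := 1 / (16 * d ^ 2 * (1 + 2 ^ d)) * s
  rcases (hf.logConcave.nonneg z).eq_or_lt with hz | hz
  · rw [← hz]; positivity
  obtain ⟨c, hc⟩ := hf.exists_cube hd hz
  obtain ⟨F, hF, hFc⟩ := exists_finset_int_cube c hs
  have h1 : F.card * (f z / 4) ≤ 1 := by
    refine le_trans ?_ (hsum F)
    rw [← nsmul_eq_mul]
    exact Finset.card_nsmul_le_sum _ _ _ fun k hk => hc _ (hFc k hk)
  rw [le_div_iff₀ (by positivity)]
  have : h ^ d * (f z / 4) ≤ 1 := le_trans (by gcongr) h1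
  linarith

/-- The sum of the second central moments of the coordinates. -/
theorem IsSpread.integral_sq_dist (hf : IsSpread s f) :
    ∃ μ : Fin d → ℝ, Integrable (fun x => (∑ i, (x i - μ i) ^ 2) * f x) ∧
      ∫ x, (∑ i, (x i - μ i) ^ 2) * f x ≤ 2 * d * s ^ 2 * ∫ x, f x := by
  have hI := hf.integral_pos
  set I := ∫ x, f x with hIdef
  set μ : Fin d → ℝ := fun i => (∫ x, x i * f x) / I with hμ
  have key : ∀ i, Integrable (fun x => (x i - μ i) ^ 2 * f x) ∧
      ∫ x, (x i - μ i) ^ 2 * f x = I * covMatrix f i i := by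
    intro i
    have := hf.logConcave.integrable_affine_sq_mul hf.integrable hI (Pi.single i 1) (μ i)
    simp only [Pi.single_apply, ite_mul, one_mul, zero_mul, mul_ite, mul_one, mul_zero,
      Finset.sum_ite_eq', Finset.mem_univ, if_true] at this
    refine ⟨this.1, this.2.trans ?_⟩
    simp only [hμ, ← hIdef]
    rw [div_mul_cancel₀ _ hI.ne', sub_self]
    simp
  refine ⟨μ, ?_, ?_⟩
  · simp_rw [Finset.sum_mul]
    exact integrable_finsetSum _ fun i _ => (key i).1
  · simp_rw [Finset.sum_mul]
    rw [integral_finsetSum _ fun i _ => (key i).1]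
    calc ∑ i, ∫ x, (x i - μ i) ^ 2 * f x ≤ ∑ _i : Fin d, I * (2 * s ^ 2) :=
          Finset.sum_le_sum fun i _ => by
            rw [(key i).2]
            exact mul_le_mul_of_nonneg_left (hf.upper i) hI.le
      _ = _ := by simp; ring

theorem volume_real_closedBall_pi (c : Fin d → ℝ) {r : ℝ} (hr : 0 ≤ r) :
    volume.real (Metric.closedBall c r) = (2 * r) ^ d := by
  rw [measureReal_def, Real.volume_pi_closedBall c hr, ENNReal.toReal_ofReal (by positivity),
    Fintype.card_fin]

/-- Chebyshev: at least half of the mass lies in the cube of side `4 * d * s` about the mean, where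
`f ≤ M`. -/
theorem IsSpread.integral_le (hd : 0 < d) (hf : IsSpread s f) {M : ℝ} (hM : ∀ x, f x ≤ M) :
    ∫ x, f x ≤ 2 * M * (4 * d * s) ^ d := by
  have hd' : (1 : ℝ) ≤ d := by exact_mod_cast hd
  have hs := hf.pos
  obtain ⟨μ, hintg, hval⟩ := hf.integral_sq_dist
  set B := Metric.closedBall μ (2 * d * s) with hB
  have hBm : MeasurableSet B := Metric.isClosed_closedBall.measurableSet
  have hpt : ∀ x, f x ≤ B.indicator f x +
      (1 / (4 * d ^ 2 * s ^ 2)) * ((∑ i, (x i - μ i) ^ 2) * f x) := by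
    intro x
    have hx0 := hf.logConcave.nonneg x
    have hS0 : 0 ≤ ∑ i, (x i - μ i) ^ 2 := Finset.sum_nonneg fun i _ => sq_nonneg _
    by_cases hx : x ∈ B
    · rw [Set.indicator_of_mem hx]
      have : 0 ≤ (1 / (4 * d ^ 2 * s ^ 2)) * ((∑ i, (x i - μ i) ^ 2) * f x) := by positivity
      linarith
    · rw [Set.indicator_of_notMem hx, zero_add]
      rw [hB, mem_closedBall_iff_norm, not_le] at hx
      have h1 : 4 * d ^ 2 * s ^ 2 ≤ ∑ i, (x i - μ i) ^ 2 := by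
        refine le_trans ?_ (norm_sq_le_sum_sq (x - μ))
        have := pow_le_pow_left₀ (by positivity) hx.le 2
        linarith
      rw [one_div_mul_eq_div, le_div_iff₀ (by positivity)]
      nlinarith [mul_le_mul_of_nonneg_right h1 hx0]
  have h1 := integral_mono hf.integrable
    ((hf.integrable.indicator hBm).add (hintg.const_mul (1 / (4 * d ^ 2 * s ^ 2)))) hpt
  simp only [Pi.add_apply] at h1
  rw [integral_add (hf.integrable.indicator hBm) (hintg.const_mul _), integral_const_mul,
    integral_indicator hBm] at h1
  have h2 : ∫ x in B, f x ≤ M * (4 * d * s) ^ d := by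
    have := norm_setIntegral_le_of_norm_le_const (μ := volume) (s := B) (f := f) (C := M)
      measure_closedBall_lt_top
      (fun x _ => by rw [Real.norm_of_nonneg (hf.logConcave.nonneg x)]; exact hM x)
    rw [hB, volume_real_closedBall_pi _ (by positivity), ← hB] at this
    calc ∫ x in B, f x ≤ ‖∫ x in B, f x‖ := le_abs_self _
      _ ≤ _ := this
      _ = _ := by ring
  have h3 : 1 / (4 * d ^ 2 * s ^ 2) * ∫ x, (∑ i, (x i - μ i) ^ 2) * f x ≤ (∫ x, f x) / 2 := by
    have hI := hf.integral_pos
    calc _ ≤ 1 / (4 * d ^ 2 * s ^ 2) * (2 * d * s ^ 2 * ∫ x, f x) := by gcongr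
      _ = (∫ x, f x) / (2 * d) := by field_simp; norm_num
      _ ≤ _ := by gcongr; linarith
  linarith

/-- All cubes of side of the order of `s` on which `f` is of the order of its maximum lie within
distance `O(s)` of one point. -/
theorem IsSpread.exists_center (hd : 0 < d) (hf : IsSpread s f) {M : ℝ} (hM0 : 0 < M)
    (hM : ∀ x, f x ≤ M) {δ h : ℝ} (hδ : 0 < δ) (hh : 0 < h) :
    ∃ μ : Fin d → ℝ, ∀ c, (∀ y, ‖y - c‖ ≤ h * s → δ * M ≤ f y) →
      ‖c - μ‖ ≤ (2 * h + 1 + 16 * d * (4 * d) ^ d / (δ * (2 * h) ^ d)) * s := by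
  have hs := hf.pos
  obtain ⟨μ, hintg, hval⟩ := hf.integral_sq_dist
  refine ⟨μ, fun c hc => ?_⟩
  set Q := 16 * d * (4 * d : ℝ) ^ d / (δ * (2 * h) ^ d) with hQ
  have hQ0 : 0 ≤ Q := by positivity
  rcases le_or_gt ‖c - μ‖ (2 * h * s) with hle | hgt
  · have : 0 ≤ (1 + Q) * s := by positivity
    linarith
  set B := Metric.closedBall c (h * s) with hB
  -- All points of the cube about `c` are at distance at least `‖c - μ‖ / 2` from `μ`, so the cube
  -- alone contributes this much to the second moment.
  have h1 : (‖c - μ‖ / 2) ^ 2 * (δ * M) * (2 * (h * s)) ^ d ≤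
      ∫ x, (∑ i, (x i - μ i) ^ 2) * f x := by
    rw [← volume_real_closedBall_pi c (by positivity)]
    refine (setIntegral_ge_of_const_le_real (f := fun x => (∑ i, (x i - μ i) ^ 2) * f x)
      Metric.isClosed_closedBall.measurableSet measure_closedBall_lt_top.ne (fun x hx => ?_)
      hintg.integrableOn).trans (setIntegral_le_integral hintg
        (Filter.Eventually.of_forall fun x => mul_nonneg
          (Finset.sum_nonneg fun i _ => sq_nonneg _) (hf.logConcave.nonneg x)))
    rw [mem_closedBall_iff_norm] at hx
    have h2 : ‖c - μ‖ / 2 ≤ ‖x - μ‖ := by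
      have h3 : ‖c - μ‖ ≤ ‖x - μ‖ + ‖x - c‖ := by
        have := norm_sub_le (x - μ) (x - c)
        rwa [sub_sub_sub_cancel_left] at this
      linarith
    have h4 : (‖c - μ‖ / 2) ^ 2 ≤ ∑ i, (x i - μ i) ^ 2 :=
      (pow_le_pow_left₀ (by positivity) h2 2).trans (norm_sq_le_sum_sq (x - μ))
    exact mul_le_mul h4 (hc x hx) (by positivity) (by positivity)
  have h2 := hf.integral_le hd hM
  have h3 : (‖c - μ‖ / 2) ^ 2 * (δ * M) * (2 * (h * s)) ^ d ≤
      2 * d * s ^ 2 * (2 * M * (4 * d * s) ^ d) := by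
    refine (h1.trans hval).trans ?_
    gcongr
  have h4 : ‖c - μ‖ ^ 2 ≤ Q * s ^ 2 := by
    have h5 : ‖c - μ‖ ^ 2 * (δ * (2 * h) ^ d * (M * s ^ d / 4)) ≤
        (16 * d * (4 * d : ℝ) ^ d) * s ^ 2 * (M * s ^ d / 4) := by
      calc _ = (‖c - μ‖ / 2) ^ 2 * (δ * M) * (2 * (h * s)) ^ d := by
            rw [← mul_assoc 2 h s, mul_pow _ s]; ring
        _ ≤ _ := h3
        _ = _ := by rw [mul_pow _ s]; ring
    rw [← mul_assoc] at h5
    have h6 := le_of_mul_le_mul_right h5 (by positivity)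
    rw [hQ, div_mul_eq_mul_div, le_div_iff₀ (by positivity)]
    exact h6
  have h7 : ‖c - μ‖ ≤ (1 + Q) * s := by
    apply le_of_sq_le_sq _ (by positivity)
    refine h4.trans ?_
    rw [mul_pow]
    gcongr
    nlinarith
  have : 0 ≤ 2 * h * s := by positivity
  linarith

/-- Exponential decay on the scale `s` of a log-concave function with covariance matrix of the
order of `s ^ 2` and sum over the lattice at most one. -/
theorem IsSpread.exists_decay (hd : 0 < d) :
    ∃ A b s₀ : ℝ, 0 < A ∧ 0 < b ∧ 0 < s₀ ∧ ∀ (s : ℝ) (f : (Fin d → ℝ) → ℝ), IsSpread s f → s₀ ≤ s →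
      (∀ F : Finset (Fin d → ℤ), ∑ k ∈ F, f (fun i => (k i : ℝ)) ≤ 1) →
      ∃ c : Fin d → ℝ, ∀ x, f x ≤ A / s ^ d * ∏ i, Real.exp (-(b / s * |x i - c i|)) := by
  have hd' : (0 : ℝ) < d := by exact_mod_cast hd
  set ρ : ℝ := 1 / (16 * d ^ 2 * (1 + 2 ^ d)) with hρ
  have hρ0 : 0 < ρ := by positivity
  -- The constant of `exists_center` for height `δ = 1 / 16` and half-side `h = ρ / 2`, the
  -- half-side left after contraction to a midpoint.
  set C : ℝ := 2 * (ρ / 2) + 1 + 16 * d * (4 * d) ^ d / ((1 / 16) * (2 * (ρ / 2)) ^ d) with hC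
  have hC0 : 0 < C := by positivity
  set R : ℝ := 4 * C + 1 with hR
  have hR0 : 0 < R := by positivity
  refine ⟨8 / ρ ^ d, 1 / (2 * R * d), 1 / ρ, by positivity, by positivity, by positivity, ?_⟩
  intro s f hf hs₀ hsum
  have hs := hf.pos
  have hs1 : 1 ≤ ρ * s := by
    rw [div_le_iff₀ hρ0] at hs₀
    linarith
  have hbd := hf.le_of_sum_le hd hsum hs1
  set M := sSup (Set.range f) with hM
  have hbdd : BddAbove (Set.range f) := ⟨4 / (ρ * s) ^ d, by rintro _ ⟨x, rfl⟩; exact hbd x⟩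
  have hfM : ∀ x, f x ≤ M := fun x => le_csSup hbdd ⟨x, rfl⟩
  have hM0 : 0 < M := by
    obtain ⟨z, ε, δ, hε, hδ, hball⟩ := hf.logConcave.exists_ball hf.integral_pos
    exact hδ.trans_le ((hball z (by simpa using hε.le)).trans (hfM z))
  have hMle : M ≤ 4 / (ρ * s) ^ d := csSup_le ⟨_, 0, rfl⟩ (by rintro _ ⟨x, rfl⟩; exact hbd x)
  obtain ⟨_, ⟨z, rfl⟩, hz⟩ := exists_lt_of_lt_csSup (s := Set.range f) ⟨_, 0, rfl⟩
    (show M / 2 < sSup (Set.range f) by linarith)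
  obtain ⟨c, hc⟩ := hf.exists_cube hd (z := z) (by linarith)
  have hc' : ∀ y, ‖y - c‖ ≤ ρ * s → 1 / 8 * M ≤ f y := fun y hy => by
    have := hc y hy
    linarith
  have hfc : 1 / 8 * M ≤ f c := hc' c (by simpa using (mul_pos hρ0 hs).le)
  obtain ⟨μ, hμ⟩ := hf.exists_center hd hM0 hfM (δ := 1 / 16) (h := ρ / 2) (by norm_num)
    (by positivity)
  have hcμ : ‖c - μ‖ ≤ C * s := hμ c fun y hy => by
    have := hc' y (hy.trans (by nlinarith))
    linarith
  -- Otherwise `f ≥ M / 16` on a cube about the midpoint of `x` and `c`. Then both the midpoint and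
  -- `c` lie within `C * s` of `μ`, so `‖x - c‖ ≤ 4 * C * s < R * s`. As `f c ≥ M / 8`, the drop
  -- from `c` is by a factor of at least `2`.
  have hfar : ∀ x, R * s ≤ ‖x - c‖ → f x ≤ 1 / 16 * M := by
    intro x hx
    by_contra! hlt
    have h1 := hμ ((1 / 2 : ℝ) • x + (1 / 2 : ℝ) • c) fun y hy =>
      hf.logConcave.le_on_midpoint_ball (t := 1 / 16 * M) (by positivity) (ε := ρ * s)
        (fun y hy => by have := hc' y hy; linarith) hlt.le (by linarith)
    have h2 : x - c = (2 : ℝ) • (((1 / 2 : ℝ) • x + (1 / 2 : ℝ) • c - μ) - (c - μ)) := by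
      ext i
      simp only [Pi.sub_apply, Pi.smul_apply, Pi.add_apply, smul_eq_mul]
      ring
    have h3 : ‖x - c‖ ≤ 2 * (C * s + C * s) := by
      rw [h2, norm_smul, Real.norm_of_nonneg (by norm_num)]
      exact mul_le_mul_of_nonneg_left ((norm_sub_le _ _).trans (add_le_add h1 hcμ)) (by norm_num)
    rw [hR] at hx
    nlinarith
  refine ⟨c, fun x => ?_⟩
  set t := ‖x - c‖ / (R * s) with ht
  have ht0 : 0 ≤ t := by positivity
  have hdec : f x ≤ 2 * M * (1 / 2) ^ t := by
    rcases le_or_gt 1 t with h1 | h1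
    · have := hf.logConcave.le_mul_rpow (z := c) (x := x) (κ := 1 / 2) (by linarith)
        (by norm_num) h1 (by
          refine (hfar _ ?_).trans (by linarith)
          rw [add_sub_cancel_left, norm_smul, norm_inv, Real.norm_of_nonneg ht0]
          have hn : 0 < ‖x - c‖ := by
            by_contra! h0
            have : t ≤ 0 := by rw [ht]; exact div_nonpos_of_nonpos_of_nonneg h0 (by positivity)
            linarith
          rw [ht, inv_div, div_mul_cancel₀ _ hn.ne'])
      refine this.trans ?_
      have := hfM c
      gcongr
      linarith
    · have h2 : (1 / 2 : ℝ) ≤ (1 / 2) ^ t := by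
        have := Real.rpow_le_rpow_of_exponent_ge (x := 1 / 2) (by norm_num) (by norm_num) h1.le
        rwa [Real.rpow_one] at this
      have := hfM x
      nlinarith
  have hexp : (1 / 2 : ℝ) ^ t ≤ ∏ i, Real.exp (-(1 / (2 * R * d) / s * |x i - c i|)) := by
    rw [← Real.exp_sum, Real.rpow_def_of_pos (by norm_num), Real.exp_le_exp]
    have hlog : Real.log (1 / 2) ≤ -(1 / 2) := by
      have := Real.log_le_sub_one_of_pos (x := 1 / 2) (by norm_num)
      linarith
    have h1 : ∑ i, |x i - c i| ≤ d * ‖x - c‖ := by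
      calc ∑ i, |x i - c i| ≤ ∑ _i : Fin d, ‖x - c‖ :=
            Finset.sum_le_sum fun i _ => norm_le_pi_norm (x - c) i
        _ = _ := by simp
    calc Real.log (1 / 2) * t ≤ -(1 / 2) * t := by gcongr
      _ = -(1 / (2 * R * d) / s * (d * ‖x - c‖)) := by rw [ht]; field_simp
      _ ≤ -(1 / (2 * R * d) / s * ∑ i, |x i - c i|) := by gcongr
      _ = _ := by rw [Finset.mul_sum, Finset.sum_neg_distrib]
  calc f x ≤ 2 * M * (1 / 2) ^ t := hdec
    _ ≤ 2 * (4 / (ρ * s) ^ d) * ∏ i, Real.exp (-(1 / (2 * R * d) / s * |x i - c i|)) := by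
        gcongr
    _ = _ := by rw [mul_pow]; field_simp; norm_num

end Decay

/-! ### Exponential sums over the lattice and summation along lines. -/

section LatticeSums

theorem tsum_fin_pi_prod (n : ℕ) (φ : Fin n → ℤ → ENNReal) :
    ∑' k : Fin n → ℤ, ∏ i, φ i (k i) = ∏ i, ∑' t, φ i t := by
  induction n with
  | zero => simp
  | succ n ih =>
    rw [← (Fin.consEquiv fun _ : Fin (n + 1) => ℤ).tsum_eq, Fin.prod_univ_succ, ← ih,
      ← ENNReal.tsum_mul_right]
    simp_rw [← ENNReal.tsum_mul_left]
    rw [← ENNReal.tsum_prod (f := fun a (b : Fin n → ℤ) => φ 0 a * ∏ i, φ i.succ (b i))]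
    refine tsum_congr fun p => ?_
    rw [Fin.prod_univ_succ]
    simp [Fin.consEquiv]

theorem tsum_pi_prod {ι : Type*} [Fintype ι] (φ : ι → ℤ → ENNReal) :
    ∑' k : ι → ℤ, ∏ i, φ i (k i) = ∏ i, ∑' t, φ i t := by
  classical
  set e := Fintype.equivFin ι
  rw [← (Equiv.arrowCongr e.symm (Equiv.refl ℤ)).tsum_eq, ← e.symm.prod_comp,
    ← tsum_fin_pi_prod]
  refine tsum_congr fun k => ?_
  rw [← e.symm.prod_comp]
  simp [Equiv.arrowCongr]

/-- The constant in the bound for exponential sums over the lattice. -/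
noncomputable def expSumConst (b : ℝ) : ℝ := Real.exp b * (2 * (1 + 1 / b))

theorem expSumConst_pos {b : ℝ} (hb : 0 < b) : 0 < expSumConst b := by
  unfold expSumConst; positivity

theorem hasSum_exp_neg_nat {a : ℝ} (ha : 0 < a) :
    HasSum (fun n : ℕ => Real.exp (-(a * n))) (1 - Real.exp (-a))⁻¹ := by
  have := hasSum_geometric_of_lt_one (Real.exp_pos (-a)).le (Real.exp_lt_one_iff.2 (by linarith))
  convert this using 2 with n
  rw [← Real.exp_nat_mul]; ring_nf

/-- Recentring at `⌊x⌋` costs `exp (b / s) ≤ exp b`; what remains is a two-sided geometric series of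
size at most `2 * (1 + s / b)`. -/
theorem tsum_exp_abs_le {b s : ℝ} (hb : 0 < b) (hs : 1 ≤ s) (x : ℝ) :
    ∑' t : ℤ, ENNReal.ofReal (Real.exp (-(b / s * |t - x|))) ≤
      ENNReal.ofReal (expSumConst b * s) := by
  have hs0 : 0 < s := by linarith
  set a := b / s with ha
  have ha0 : 0 < a := by positivity
  have hab : a ≤ b := div_le_self hb.le hs
  have hgeo : HasSum (fun t : ℤ => Real.exp (-(a * |(t : ℝ)|)))
      ((1 - Real.exp (-a))⁻¹ + Real.exp (-a) * (1 - Real.exp (-a))⁻¹) := by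
    apply HasSum.of_nat_of_neg_add_one
    · simpa using hasSum_exp_neg_nat ha0
    · refine ((hasSum_exp_neg_nat ha0).mul_left (Real.exp (-a))).congr_fun fun n => ?_
      rw [← Real.exp_add]
      congr 1
      push_cast
      rw [abs_neg, abs_of_nonneg (by positivity)]
      ring
  have hval : (1 - Real.exp (-a))⁻¹ + Real.exp (-a) * (1 - Real.exp (-a))⁻¹ ≤ 2 * (1 + 1 / a) := by
    have h1 : Real.exp (-a) * (1 + a) ≤ 1 := by
      have := Real.add_one_le_exp a
      rw [Real.exp_neg, inv_mul_le_iff₀ (Real.exp_pos a)]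
      linarith
    have h2 : a / (1 + a) ≤ 1 - Real.exp (-a) := by
      rw [div_le_iff₀ (by positivity)]
      linarith
    have h3 : (1 - Real.exp (-a))⁻¹ ≤ 1 + 1 / a := by
      calc (1 - Real.exp (-a))⁻¹ ≤ (a / (1 + a))⁻¹ := by gcongr
        _ = 1 + 1 / a := by field_simp; ring
    have h4 : Real.exp (-a) ≤ 1 := (Real.exp_lt_one_iff.2 (by linarith)).le
    have h5 : 0 ≤ (1 - Real.exp (-a))⁻¹ := inv_nonneg.2 (by linarith)
    nlinarith
  calc ∑' t : ℤ, ENNReal.ofReal (Real.exp (-(a * |t - x|)))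
      = ∑' t : ℤ, ENNReal.ofReal (Real.exp (-(a * |((t + ⌊x⌋ : ℤ) : ℝ) - x|))) :=
        ((Equiv.addRight ⌊x⌋).tsum_eq
          fun t : ℤ => ENNReal.ofReal (Real.exp (-(a * |t - x|)))).symm
    _ ≤ ∑' t : ℤ, ENNReal.ofReal (Real.exp a * Real.exp (-(a * |(t : ℝ)|))) := by
        refine ENNReal.tsum_le_tsum fun t => ENNReal.ofReal_le_ofReal ?_
        rw [← Real.exp_add, Real.exp_le_exp]
        have h1 : |(t : ℝ)| ≤ |((t + ⌊x⌋ : ℤ) : ℝ) - x| + 1 := by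
          have h2 := Int.floor_le x
          have h3 := Int.lt_floor_add_one x
          have h4 : (t : ℝ) = (((t + ⌊x⌋ : ℤ) : ℝ) - x) + (x - ⌊x⌋) := by push_cast; ring
          calc |(t : ℝ)| = |(((t + ⌊x⌋ : ℤ) : ℝ) - x) + (x - ⌊x⌋)| := by rw [← h4]
            _ ≤ |((t + ⌊x⌋ : ℤ) : ℝ) - x| + |x - ⌊x⌋| := abs_add_le _ _
            _ ≤ _ := by rw [abs_of_nonneg (sub_nonneg.2 h2)]; linarith
        nlinarith
    _ = ENNReal.ofReal (Real.exp a *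
          ((1 - Real.exp (-a))⁻¹ + Real.exp (-a) * (1 - Real.exp (-a))⁻¹)) := by
        rw [← (hgeo.mul_left _).tsum_eq, ENNReal.ofReal_tsum_of_nonneg
          (fun t => by positivity) (hgeo.mul_left _).summable]
    _ ≤ ENNReal.ofReal (expSumConst b * s) := by
        refine ENNReal.ofReal_le_ofReal ?_
        calc _ ≤ Real.exp a * (2 * (1 + 1 / a)) := by gcongr
          _ ≤ Real.exp b * (2 * (s + s / b)) := by
              rw [ha, one_div_div]; gcongr
          _ = _ := by unfold expSumConst; ring

theorem tsum_prod_exp_le {b s : ℝ} (hb : 0 < b) (hs : 1 ≤ s) {ι : Type*} [Fintype ι]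
    (c : ι → ℝ) :
    ∑' k : ι → ℤ, ENNReal.ofReal (∏ i, Real.exp (-(b / s * |k i - c i|))) ≤
      ENNReal.ofReal ((expSumConst b * s) ^ Fintype.card ι) := by
  simp_rw [ENNReal.ofReal_prod_of_nonneg fun i _ => (Real.exp_pos _).le]
  rw [tsum_pi_prod fun i t => ENNReal.ofReal (Real.exp (-(b / s * |t - c i|))),
    ENNReal.ofReal_pow (mul_nonneg (expSumConst_pos hb).le (by linarith))]
  exact Finset.prod_le_pow_card _ _ _ fun i _ => tsum_exp_abs_le hb hs (c i)

/-- The lattice point with `i`-th coordinate `t` and other coordinates `k`. -/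
def lineMk {d : ℕ} (i : Fin d) (k : {j // j ≠ i} → ℤ) (t : ℤ) : Fin d → ℤ :=
  (Equiv.funSplitAt i ℤ).symm (t, k)

theorem lineMk_self {d : ℕ} (i : Fin d) (k : {j // j ≠ i} → ℤ) (t : ℤ) : lineMk i k t i = t := by
  simp [lineMk, Equiv.funSplitAt, Equiv.piSplitAt]

theorem lineMk_of_ne {d : ℕ} {i j : Fin d} (h : j ≠ i) (k : {j // j ≠ i} → ℤ) (t : ℤ) :
    lineMk i k t j = k ⟨j, h⟩ := by
  simp [lineMk, Equiv.funSplitAt, Equiv.piSplitAt, h]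

theorem lineMk_add_single {d : ℕ} (i : Fin d) (k : {j // j ≠ i} → ℤ) (t : ℤ) :
    lineMk i k t + Pi.single i 1 = lineMk i k (t + 1) := by
  ext j
  by_cases h : j = i
  · subst h
    simp [lineMk_self]
  · simp [lineMk_of_ne h, h]

/-- A sum over the lattice is bounded if the sums over the lines parallel to a coordinate axis
decay exponentially. -/
theorem tsum_le_of_lines {d : ℕ} {b s : ℝ} (hb : 0 < b) (hs : 1 ≤ s) (i : Fin d) (c : Fin d → ℝ)
    (ψ : (Fin d → ℤ) → ENNReal) {β : ℝ} (hβ : 0 ≤ β)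
    (h : ∀ k : {j // j ≠ i} → ℤ, ∑' t, ψ (lineMk i k t) ≤
      ENNReal.ofReal (β * ∏ j, Real.exp (-(b / s * |k j - c j|)))) :
    ∑' k, ψ k ≤ ENNReal.ofReal (β * (expSumConst b * s) ^ (d - 1)) := by
  rw [← (Equiv.funSplitAt i ℤ).symm.tsum_eq]
  rw [ENNReal.tsum_prod (f := fun t k => ψ ((Equiv.funSplitAt i ℤ).symm (t, k))),
    ENNReal.tsum_comm]
  calc _ ≤ ∑' k : {j // j ≠ i} → ℤ, ENNReal.ofReal β *
        ENNReal.ofReal (∏ j, Real.exp (-(b / s * |k j - c j|))) :=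
        ENNReal.tsum_le_tsum fun k => (h k).trans_eq (ENNReal.ofReal_mul hβ)
    _ ≤ _ := by
        rw [ENNReal.tsum_mul_left, ENNReal.ofReal_mul hβ]
        gcongr
        have := tsum_prod_exp_le hb hs (fun j : {j // j ≠ i} => c j)
        simpa [Fintype.card_subtype_compl] using this

end LatticeSums

/-! ### Variation of unimodal sequences. -/

section Unimodal

/-- A unimodal sequence rises to its maximum and then falls. The induction records two bounds: `q n`
while `q n` is still the running maximum, and `2 * B - q n` at all times. -/
theorem sum_abs_sub_le_of_unimodal {q : ℕ → ℝ} {B : ℝ} (h0 : ∀ j, 0 ≤ q j) (hB : ∀ j, q j ≤ B)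
    (hq : ∀ i j k, i ≤ j → j ≤ k → min (q i) (q k) ≤ q j) (n : ℕ) :
    ∑ j ∈ Finset.range n, |q (j + 1) - q j| ≤ 2 * B := by
  suffices h : ∑ j ∈ Finset.range n, |q (j + 1) - q j| ≤ 2 * B - q n ∧
      ((∀ j ≤ n, q j ≤ q n) → ∑ j ∈ Finset.range n, |q (j + 1) - q j| ≤ q n) by
    linarith [h.1, h0 n]
  induction n with
  | zero => simpa using ⟨by linarith [h0 0, hB 0], h0 0⟩
  | succ n ih =>
    rw [Finset.sum_range_succ]
    rcases le_or_gt (q (n + 1)) (q n) with hle | hlt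
    · rw [abs_of_nonpos (by linarith)]
      refine ⟨by linarith [ih.1], fun hmax => ?_⟩
      have h1 : q n = q (n + 1) := le_antisymm (hmax n (by omega)) hle
      have := ih.2 fun j hj => (hmax j (by omega)).trans hle
      linarith
    · have h1 : ∀ j ≤ n, q j ≤ q n := by
        intro j hj
        have := hq j n (n + 1) hj (by omega)
        rcases min_le_iff.1 this with h | h
        · exact h
        · linarith
      have h2 := ih.2 h1
      rw [abs_of_pos (by linarith)]
      exact ⟨by linarith [hB (n + 1)], fun _ => by linarith⟩

theorem tsum_abs_sub_le_of_unimodal {q : ℤ → ℝ} {B : ℝ} (h0 : ∀ j, 0 ≤ q j) (hB : ∀ j, q j ≤ B)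
    (hq : ∀ i j k, i ≤ j → j ≤ k → min (q i) (q k) ≤ q j) :
    ∑' t, ENNReal.ofReal |q (t + 1) - q t| ≤ ENNReal.ofReal (4 * B) := by
  have hnat : ∀ r : ℕ → ℝ, (∀ j, 0 ≤ r j) → (∀ j, r j ≤ B) →
      (∀ i j k, i ≤ j → j ≤ k → min (r i) (r k) ≤ r j) →
      ∑' n : ℕ, ENNReal.ofReal |r (n + 1) - r n| ≤ ENNReal.ofReal (2 * B) := by
    intro r h0 hB hr
    rw [ENNReal.tsum_eq_iSup_nat]
    refine iSup_le fun n => ?_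
    rw [← ENNReal.ofReal_sum_of_nonneg fun _ _ => abs_nonneg _]
    exact ENNReal.ofReal_le_ofReal (sum_abs_sub_le_of_unimodal h0 hB hr n)
  have hB0 : 0 ≤ B := (h0 0).trans (hB 0)
  rw [tsum_of_nat_of_neg_add_one ENNReal.summable ENNReal.summable,
    show 4 * B = 2 * B + 2 * B by ring, ENNReal.ofReal_add (by positivity) (by positivity)]
  refine add_le_add ?_ ?_
  · have := hnat (fun n => q n) (fun n => h0 n) (fun n => hB n)
      (fun i j k hij hjk => hq i j k (by omega) (by omega))
    simpa using this
  · have := hnat (fun n => q (-n)) (fun n => h0 _) (fun n => hB _)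
      (fun i j k hij hjk => by
        rw [min_comm]
        exact hq _ _ _ (by omega) (by omega))
    refine le_trans (ENNReal.tsum_le_tsum fun n => ?_) this
    rw [abs_sub_comm]
    push_cast
    simp

theorem IsLogConcave.min_le {d : ℕ} {f : (Fin d → ℝ) → ℝ} (hf : IsLogConcave f)
    (x y : Fin d → ℝ) {a b : ℝ} (ha : 0 ≤ a) (hb : 0 ≤ b) (hab : a + b = 1) :
    min (f x) (f y) ≤ f (a • x + b • y) := by
  rcases (le_min (hf.nonneg x) (hf.nonneg y)).eq_or_lt with h | h
  · rw [← h]; exact hf.nonneg _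
  · exact hf.convex_superlevel h (show min (f x) (f y) ≤ f x from min_le_left _ _)
      (show min (f x) (f y) ≤ f y from min_le_right _ _) ha hb hab

theorem IsLogConcave.unimodal_lineMk {d : ℕ} {f : (Fin d → ℝ) → ℝ} (hf : IsLogConcave f)
    (i : Fin d) (k : {j // j ≠ i} → ℤ) {u v w : ℤ} (huv : u ≤ v) (hvw : v ≤ w) :
    min (f fun j => (lineMk i k u j : ℝ)) (f fun j => (lineMk i k w j : ℝ)) ≤
      f fun j => (lineMk i k v j : ℝ) := by
  rcases huv.eq_or_lt with rfl | huv'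
  · exact min_le_left _ _
  have h1 : (u : ℝ) < v := by exact_mod_cast huv'
  have h2 : (v : ℝ) ≤ w := by exact_mod_cast hvw
  have h3 : (0 : ℝ) < w - u := by linarith
  have := hf.min_le (fun j => (lineMk i k u j : ℝ)) (fun j => (lineMk i k w j : ℝ))
    (a := (w - v) / (w - u)) (b := (v - u) / (w - u)) (div_nonneg (by linarith) h3.le)
    (div_nonneg (by linarith) h3.le) (by field_simp; ring)
  convert this using 2
  ext j
  simp only [Pi.add_apply, Pi.smul_apply, smul_eq_mul]
  by_cases h : j = i
  · subst h
    simp only [lineMk_self]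
    field_simp
    ring
  · simp only [lineMk_of_ne h]
    field_simp
    ring

end Unimodal

/-! ### Total variation of the mass function under lattice shifts. -/

section TotalVariation

variable {d : ℕ}

/-- The total variation of `p` with respect to the shift by `v`. -/
noncomputable def shiftVariation (p : (Fin d → ℤ) → ℝ) (v : Fin d → ℤ) : ENNReal :=
  ∑' k, ENNReal.ofReal |p (k + v) - p k|

theorem shiftVariation_zero (p : (Fin d → ℤ) → ℝ) : shiftVariation p 0 = 0 := by
  simp [shiftVariation]

theorem shiftVariation_add (p : (Fin d → ℤ) → ℝ) (v w : Fin d → ℤ) :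
    shiftVariation p (v + w) ≤ shiftVariation p v + shiftVariation p w := by
  unfold shiftVariation
  rw [← (Equiv.addRight w).tsum_eq fun k => ENNReal.ofReal |p (k + v) - p k|, ← ENNReal.tsum_add]
  refine ENNReal.tsum_le_tsum fun k => ?_
  rw [← ENNReal.ofReal_add (abs_nonneg _) (abs_nonneg _)]
  refine ENNReal.ofReal_le_ofReal ?_
  have := abs_add_le (p (k + w + v) - p (k + w)) (p (k + w) - p k)
  rw [sub_add_sub_cancel] at this
  rwa [show k + (v + w) = k + w + v by abel]

theorem shiftVariation_neg (p : (Fin d → ℤ) → ℝ) (v : Fin d → ℤ) :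
    shiftVariation p (-v) = shiftVariation p v := by
  unfold shiftVariation
  rw [← (Equiv.addRight v).tsum_eq]
  refine tsum_congr fun k => ?_
  simp [abs_sub_comm]

theorem shiftVariation_zsmul (p : (Fin d → ℤ) → ℝ) (v : Fin d → ℤ) (z : ℤ) :
    shiftVariation p (z • v) ≤ z.natAbs * shiftVariation p v := by
  have hnat : ∀ n : ℕ, shiftVariation p (n • v) ≤ n * shiftVariation p v := by
    intro n
    induction n with
    | zero => simp [shiftVariation_zero]
    | succ n ih =>
      rw [succ_nsmul]
      refine (shiftVariation_add p _ _).trans ?_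
      push_cast
      rw [add_mul, one_mul]
      gcongr
  obtain ⟨n, rfl | rfl⟩ := z.eq_nat_or_neg
  · rw [natCast_zsmul, Int.natAbs_natCast]
    exact hnat n
  · rw [neg_zsmul, natCast_zsmul, shiftVariation_neg, Int.natAbs_neg, Int.natAbs_natCast]
    exact hnat n

/-- The variation is subadditive in the shift, so a general shift is paid for by unit steps along
the axes. -/
theorem shiftVariation_le (p : (Fin d → ℤ) → ℝ) {T : ENNReal}
    (hT : ∀ i, shiftVariation p (Pi.single i 1) ≤ T) {n : ℕ} {v : Fin d → ℤ}
    (hv : ∀ i, (v i).natAbs ≤ n) : shiftVariation p v ≤ d * n * T := by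
  have hsum : v = ∑ i, v i • (Pi.single i 1 : Fin d → ℤ) := by
    ext j
    simp [Finset.sum_apply, Pi.single_apply]
  rw [hsum]
  refine (Finset.le_sum_of_subadditive (shiftVariation p) (shiftVariation_zero p).le
    (shiftVariation_add p) _ _).trans ?_
  calc _ ≤ ∑ _i : Fin d, (n : ENNReal) * T := Finset.sum_le_sum fun i _ =>
        (shiftVariation_zsmul p _ _).trans
          (mul_le_mul' (by exact_mod_cast hv i) (hT i))
    _ = _ := by simp [mul_assoc]

/-- The decay of the values of a log-concave function on the lattice on the scale `s`. -/
def HasDecay (A b s : ℝ) (c : Fin d → ℝ) (p : (Fin d → ℤ) → ℝ) : Prop :=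
  ∀ k, p k ≤ A / s ^ d * ∏ i, Real.exp (-(b / s * |k i - c i|))

theorem prod_lineMk_exp_le {a : ℝ} (ha : 0 ≤ a) (c : Fin d → ℝ) (i : Fin d)
    (k : {j // j ≠ i} → ℤ) (t : ℤ) :
    ∏ j, Real.exp (-(a * |lineMk i k t j - c j|)) ≤
      ∏ j : {j // j ≠ i}, Real.exp (-(a * |k j - c j|)) := by
  rw [Fintype.prod_eq_mul_prod_subtype_ne _ i]
  calc _ ≤ 1 * ∏ j : {j // j ≠ i}, Real.exp (-(a * |lineMk i k t j - c j|)) := by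
        gcongr
        rw [Real.exp_le_one_iff]
        have := mul_nonneg ha (abs_nonneg ((lineMk i k t i : ℝ) - c i))
        linarith
    _ = _ := by
        rw [one_mul]
        exact Finset.prod_congr rfl fun j _ => by rw [lineMk_of_ne j.2]

/-- Unimodality bounds the variation on each line by four times the supremum, of order `s ^ (-d)`
times the decay in the other coordinates; summing over the lines restores only `s ^ (d - 1)`. -/
theorem shiftVariation_single_le {A b s : ℝ} (hA : 0 < A) (hb : 0 < b) (hs : 1 ≤ s)
    {c : Fin d → ℝ} {p : (Fin d → ℤ) → ℝ} {f : (Fin d → ℝ) → ℝ} (hf : IsLogConcaveExtension p f)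
    (hp : HasDecay A b s c p) (i : Fin d) :
    shiftVariation p (Pi.single i 1) ≤ ENNReal.ofReal (4 * A * expSumConst b ^ (d - 1) / s) := by
  have hs0 : 0 < s := by linarith
  refine (tsum_le_of_lines hb hs i c _ (β := 4 * (A / s ^ d)) (by positivity)
    fun k => ?_).trans_eq ?_
  · simp_rw [lineMk_add_single]
    rw [mul_assoc]
    refine tsum_abs_sub_le_of_unimodal (q := fun t => p (lineMk i k t))
      (fun t => by rw [← hf.2]; exact hf.1.nonneg _) (fun t => (hp _).trans ?_)
      (fun u v w huv hvw => ?_)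
    · gcongr
      exact prod_lineMk_exp_le (by positivity) c i k t
    · simp only [← hf.2]
      exact hf.1.unimodal_lineMk i k huv hvw
  · congr 1
    have : 0 < d := i.pos
    obtain ⟨m, rfl⟩ : ∃ m, d = m + 1 := ⟨d - 1, by omega⟩
    rw [Nat.add_sub_cancel, mul_pow, pow_succ]
    field_simp

end TotalVariation

/-! ### The Jensen gap of `-t log t`. -/

section JensenGap

/-- The weight `w` removes the logarithm: `w * a ≤ m` gives `a / m ≤ 1 / w`, and `w * log (1 / w) ≤
1`. Splitting `a = (a - m) + m` and using `m * log (a / m) ≤ a - m` on the second part gives the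
constant `2`. -/
theorem mul_mul_log_sub_le {w a m : ℝ} (hw0 : 0 ≤ w) (hw1 : w ≤ 1) (ha : 0 ≤ a) (hm : w * a ≤ m) :
    w * (a * (Real.log a - Real.log m)) ≤ 2 * |a - m| := by
  rcases hw0.eq_or_lt with rfl | hw
  · rw [zero_mul]; positivity
  rcases ha.eq_or_lt with rfl | ha
  · rw [zero_mul, mul_zero]; positivity
  have hm0 : 0 < m := lt_of_lt_of_le (by positivity) hm
  rw [← Real.log_div ha.ne' hm0.ne']
  rcases le_or_gt a m with hle | hlt
  · have : Real.log (a / m) ≤ 0 := Real.log_nonpos (by positivity) ((div_le_one hm0).2 hle)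
    have h2 : w * (a * Real.log (a / m)) ≤ 0 :=
      mul_nonpos_of_nonneg_of_nonpos hw.le (mul_nonpos_of_nonneg_of_nonpos ha.le this)
    linarith [abs_nonneg (a - m)]
  · rw [abs_of_pos (by linarith)]
    have h1 : Real.log (a / m) ≤ a / m - 1 := Real.log_le_sub_one_of_pos (by positivity)
    have h2 : m * Real.log (a / m) ≤ a - m := by
      calc m * Real.log (a / m) ≤ m * (a / m - 1) := by gcongr
        _ = a - m := by field_simp
    have h3 : w * Real.log (a / m) ≤ 1 := by
      have h4 : a / m ≤ 1 / w := by
        rw [div_le_div_iff₀ hm0 hw]; linarith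
      calc w * Real.log (a / m) ≤ w * (a / m - 1) := by gcongr
        _ ≤ w * (1 / w - 1) := by gcongr
        _ = 1 - w := by field_simp
        _ ≤ 1 := by linarith
    have h5 : 0 ≤ Real.log (a / m) := Real.log_nonneg ((one_le_div hm0).2 hlt.le)
    calc w * (a * Real.log (a / m))
        = (a - m) * (w * Real.log (a / m)) + w * (m * Real.log (a / m)) := by ring
      _ ≤ (a - m) * 1 + 1 * (m * Real.log (a / m)) := by gcongr
      _ ≤ _ := by linarith

theorem sum_negMulLog_le {ι : Type*} (K : Finset ι) (w a : ι → ℝ) (hw : ∀ k ∈ K, 0 ≤ w k)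
    (hw1 : ∑ k ∈ K, w k = 1) (ha : ∀ k ∈ K, 0 ≤ a k) :
    ∑ k ∈ K, w k * Real.negMulLog (a k) ≤ Real.negMulLog (∑ k ∈ K, w k * a k) :=
  Real.concaveOn_negMulLog.le_map_sum hw hw1 ha

/-- The Jensen gap of the entropy function is bounded by the total oscillation of the values. -/
theorem negMulLog_sum_le {ι : Type*} (K : Finset ι) (w a : ι → ℝ) (hw : ∀ k ∈ K, 0 ≤ w k)
    (hw1 : ∑ k ∈ K, w k = 1) (ha : ∀ k ∈ K, 0 ≤ a k) :
    Real.negMulLog (∑ k ∈ K, w k * a k) ≤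
      ∑ k ∈ K, w k * Real.negMulLog (a k) + 2 * ∑ k ∈ K, ∑ l ∈ K, |a k - a l| := by
  set m := ∑ k ∈ K, w k * a k with hm
  have hwle : ∀ k ∈ K, w k ≤ 1 := fun k hk => hw1 ▸ Finset.single_le_sum hw hk
  have h1 : Real.negMulLog m - ∑ k ∈ K, w k * Real.negMulLog (a k) =
      ∑ k ∈ K, w k * (a k * (Real.log (a k) - Real.log m)) := by
    have : Real.negMulLog m = ∑ k ∈ K, -(w k * a k * Real.log m) := by
      rw [Real.negMulLog, Finset.sum_neg_distrib, ← Finset.sum_mul, neg_mul]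
    rw [this, ← Finset.sum_sub_distrib]
    exact Finset.sum_congr rfl fun k _ => by rw [Real.negMulLog]; ring
  have h2 : ∑ k ∈ K, w k * (a k * (Real.log (a k) - Real.log m)) ≤
      ∑ k ∈ K, 2 * ∑ l ∈ K, |a k - a l| := by
    refine Finset.sum_le_sum fun k hk => ?_
    refine (mul_mul_log_sub_le (hw k hk) (hwle k hk) (ha k hk) ?_).trans ?_
    · exact Finset.single_le_sum (f := fun k => w k * a k)
        (fun l hl => mul_nonneg (hw l hl) (ha l hl)) hk
    · gcongr
      have : a k - m = ∑ l ∈ K, w l * (a k - a l) := by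
        simp only [mul_sub, Finset.sum_sub_distrib]
        rw [← Finset.sum_mul, hw1, one_mul, hm]
      rw [this]
      refine (Finset.abs_sum_le_sum_abs _ _).trans (Finset.sum_le_sum fun l hl => ?_)
      rw [abs_mul, abs_of_nonneg (hw l hl)]
      exact mul_le_of_le_one_left (abs_nonneg _) (hwle l hl)
  rw [Finset.mul_sum]
  linarith

end JensenGap

/-! ### Entropy under smoothing by a partition of unity. -/

section Smoothing

variable {d : ℕ}

/-- The lattice point below `x`. -/
noncomputable def floorVec (x : Fin d → ℝ) : Fin d → ℤ := fun i => ⌊x i⌋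

/-- The real vector of a lattice point. -/
def castVec (k : Fin d → ℤ) : Fin d → ℝ := fun i => (k i : ℝ)

theorem measurable_floorVec : Measurable (floorVec (d := d)) :=
  measurable_pi_lambda _ fun i => Int.measurable_floor.comp (measurable_pi_apply i)

theorem lintegral_floorVec (F : (Fin d → ℤ) → ENNReal) :
    ∫⁻ x : Fin d → ℝ, F (floorVec x) = ∑' k, F k := by
  rw [← lintegral_map (f := F) (measurable_of_countable _) measurable_floorVec,
    lintegral_countable']
  refine tsum_congr fun k => ?_
  rw [Measure.map_apply measurable_floorVec (measurableSet_singleton k)]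
  have : floorVec ⁻¹' {k} = Set.pi Set.univ fun i => Set.Ico (k i : ℝ) (k i + 1) := by
    ext x
    simp [floorVec, funext_iff, Int.floor_eq_iff]
  rw [this, Real.volume_pi_Ico]
  simp

theorem tsum_shift_abs (p : (Fin d → ℤ) → ℝ) (a b : Fin d → ℤ) :
    ∑' k, ENNReal.ofReal |p (k - a) - p (k - b)| = shiftVariation p (b - a) := by
  rw [shiftVariation, ← (Equiv.addRight b).tsum_eq]
  refine tsum_congr fun k => ?_
  simp only [Equiv.coe_addRight]
  rw [add_sub_cancel_right, add_sub_assoc]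

/-- Smoothing a mass function on the lattice by a partition of unity of bounded support increases
the entropy by at most the order of its variation. -/
theorem entropy_smoothing {n : ℕ} {p : (Fin d → ℤ) → ℝ} (hp0 : ∀ k, 0 ≤ p k) (hp1 : ∀ k, p k ≤ 1)
    (hH : Summable fun k => Real.negMulLog (p k)) {τ : ℝ} (hτ0 : 0 ≤ τ)
    (hT : ∀ i, shiftVariation p (Pi.single i 1) ≤ ENNReal.ofReal τ)
    {u : (Fin d → ℝ) → ENNReal} (hum : Measurable u) (hu : ∫⁻ x, u x = 1)
    (hpart : ∀ x, ∑' k, u (x - castVec k) = 1)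
    (hsupp : ∀ x, u x ≠ 0 → ∀ i, 0 ≤ x i ∧ x i ≤ n) :
    Integrable (fun x => Real.negMulLog (∑' k, ENNReal.ofReal (p k) * u (x - castVec k)).toReal) ∧
    ∑' k, Real.negMulLog (p k) ≤
      ∫ x, Real.negMulLog (∑' k, ENNReal.ofReal (p k) * u (x - castVec k)).toReal ∧
    ∫ x, Real.negMulLog (∑' k, ENNReal.ofReal (p k) * u (x - castVec k)).toReal ≤
      ∑' k, Real.negMulLog (p k) + 2 * ((n + 1) ^ d) ^ 2 * d * n * τ := by
  classical
  set g : (Fin d → ℝ) → ENNReal := fun x => ∑' k, ENNReal.ofReal (p k) * u (x - castVec k) with hg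
  have hη0 : ∀ k, 0 ≤ Real.negMulLog (p k) := fun k => Real.negMulLog_nonneg (hp0 k) (hp1 k)
  have hshift : ∀ k : Fin d → ℤ, Measurable fun x => u (x - castVec k) := fun k =>
    hum.comp (measurable_id.sub_const _)
  have hgm : Measurable g := Measurable.tsum fun k => (hshift k).const_mul _
  -- If `u (x - k) ≠ 0`, then `floorVec x - k` lies in this box of `(n + 1) ^ d` points, so `g x`
  -- involves only finitely many values of `p`.
  set B : Finset (Fin d → ℤ) := Fintype.piFinset fun _ => Finset.Icc 0 (n : ℤ) with hB
  -- `φ` averages the values of `-p log p` with the weights defining `g`; its integral is exactly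
  -- the Shannon entropy. `E` bounds the Jensen gap and depends on `x` only through `floorVec x`, so
  -- its integral is a lattice sum of shift variations.
  set φ : (Fin d → ℝ) → ENNReal :=
    fun x => ∑' k, ENNReal.ofReal (Real.negMulLog (p k)) * u (x - castVec k) with hφ
  set E : (Fin d → ℤ) → ENNReal := fun m =>
    2 * ∑ a ∈ B, ∑ b ∈ B, ENNReal.ofReal |p (m - a) - p (m - b)| with hE
  have hpt : ∀ x, φ x ≤ ENNReal.ofReal (Real.negMulLog (g x).toReal) ∧
      ENNReal.ofReal (Real.negMulLog (g x).toReal) ≤ φ x + E (floorVec x) := by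
    intro x
    set K : Finset (Fin d → ℤ) := B.image fun a => floorVec x - a with hK
    have hout : ∀ k, k ∉ K → u (x - castVec k) = 0 := by
      intro k hk
      by_contra hne
      apply hk
      rw [hK, Finset.mem_image]
      refine ⟨floorVec x - k, ?_, by abel⟩
      rw [hB, Fintype.mem_piFinset]
      intro i
      obtain ⟨h1, h2⟩ := hsupp _ hne i
      simp only [Pi.sub_apply, castVec] at h1 h2
      rw [Finset.mem_Icc]
      simp only [Pi.sub_apply, floorVec]
      constructor
      · have : k i ≤ ⌊x i⌋ := Int.le_floor.2 (by linarith)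
        linarith
      · have : ⌊x i⌋ ≤ n + k i := by
          have h3 := Int.floor_le (x i)
          have h4 : (⌊x i⌋ : ℝ) ≤ ((n + k i : ℤ) : ℝ) := by push_cast; linarith
          exact_mod_cast h4
        linarith
    set w : (Fin d → ℤ) → ℝ := fun k => (u (x - castVec k)).toReal with hw
    have hfin : ∀ k, u (x - castVec k) ≠ ⊤ := by
      intro k h
      have := ENNReal.le_tsum (f := fun k => u (x - castVec k)) k
      rw [hpart, h] at this
      exact absurd this (by simp)
    have huw : ∀ k, u (x - castVec k) = ENNReal.ofReal (w k) := fun k =>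
      (ENNReal.ofReal_toReal (hfin k)).symm
    have hw0 : ∀ k, 0 ≤ w k := fun k => ENNReal.toReal_nonneg
    have hsum : ∀ v : (Fin d → ℤ) → ℝ, (∀ k, 0 ≤ v k) →
        ∑' k, ENNReal.ofReal (v k) * u (x - castVec k) = ENNReal.ofReal (∑ k ∈ K, w k * v k) := by
      intro v hv
      rw [tsum_eq_sum (s := K) fun k hk => by rw [hout k hk, mul_zero],
        ENNReal.ofReal_sum_of_nonneg fun k _ => mul_nonneg (hw0 k) (hv k)]
      refine Finset.sum_congr rfl fun k _ => ?_
      rw [huw, ← ENNReal.ofReal_mul (hv k), mul_comm]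
    have hw1 : ∑ k ∈ K, w k = 1 := by
      have h1 := hsum (fun _ => 1) fun _ => zero_le_one
      simp only [ENNReal.ofReal_one, one_mul, mul_one, hpart] at h1
      have h2 : ENNReal.ofReal (∑ k ∈ K, w k) = 1 := h1.symm
      rwa [ENNReal.ofReal_eq_one] at h2
    have hgx : (g x).toReal = ∑ k ∈ K, w k * p k := by
      rw [hg]
      simp only
      rw [hsum p hp0, ENNReal.toReal_ofReal (Finset.sum_nonneg fun k _ =>
        mul_nonneg (hw0 k) (hp0 k))]
    rw [hgx, hφ]
    simp only
    rw [hsum _ hη0]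
    refine ⟨ENNReal.ofReal_le_ofReal (sum_negMulLog_le K w p (fun k _ => hw0 k) hw1
      fun k _ => hp0 k), ?_⟩
    have h1 := negMulLog_sum_le K w p (fun k _ => hw0 k) hw1 fun k _ => hp0 k
    refine (ENNReal.ofReal_le_ofReal h1).trans ?_
    refine ENNReal.ofReal_add_le.trans ?_
    gcongr
    rw [hE]
    simp only
    rw [ENNReal.ofReal_mul (by norm_num), ENNReal.ofReal_ofNat, hK]
    gcongr
    have hinj : Set.InjOn (fun a => floorVec x - a) B := fun a _ b _ h => sub_right_injective h
    rw [Finset.sum_image hinj, ENNReal.ofReal_sum_of_nonneg fun a _ =>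
      Finset.sum_nonneg fun _ _ => abs_nonneg _]
    refine Finset.sum_le_sum fun a _ => ?_
    rw [Finset.sum_image hinj, ENNReal.ofReal_sum_of_nonneg fun a _ => abs_nonneg _]
  have hφint : ∫⁻ x, φ x = ENNReal.ofReal (∑' k, Real.negMulLog (p k)) := by
    rw [hφ, lintegral_tsum fun k => ((hshift k).const_mul _).aemeasurable,
      ENNReal.ofReal_tsum_of_nonneg hη0 hH]
    refine tsum_congr fun k => ?_
    rw [lintegral_const_mul _ (hshift k), lintegral_sub_right_eq_self u, hu, mul_one]
  have hBcard : (B.card : ENNReal) = (n + 1) ^ d := by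
    rw [hB, Fintype.card_piFinset]
    simp
  have hEint : ∫⁻ x : Fin d → ℝ, E (floorVec x) ≤
      ENNReal.ofReal (2 * ((n + 1) ^ d) ^ 2 * d * n * τ) := by
    rw [lintegral_floorVec, hE, ENNReal.tsum_mul_left,
      Summable.tsum_finsetSum fun _ _ => ENNReal.summable]
    have h1 : ∀ a ∈ B, ∑' m, ∑ b ∈ B, ENNReal.ofReal |p (m - a) - p (m - b)| ≤
        (n + 1) ^ d * (d * n * ENNReal.ofReal τ) := by
      intro a ha
      rw [Summable.tsum_finsetSum fun _ _ => ENNReal.summable]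
      calc _ ≤ ∑ _b ∈ B, (d * n * ENNReal.ofReal τ : ENNReal) := by
            refine Finset.sum_le_sum fun b hb => ?_
            rw [tsum_shift_abs]
            refine shiftVariation_le p hT fun i => ?_
            have h1 := Fintype.mem_piFinset.1 ha i
            have h2 := Fintype.mem_piFinset.1 hb i
            rw [Finset.mem_Icc] at h1 h2
            rw [Pi.sub_apply]
            omega
        _ = _ := by rw [Finset.sum_const, nsmul_eq_mul, hBcard]
    calc _ ≤ 2 * ∑ _a ∈ B, ((n + 1) ^ d * (d * n * ENNReal.ofReal τ) : ENNReal) := by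
          gcongr with a ha
          exact h1 a ha
      _ = 2 * ((n + 1) ^ d * ((n + 1) ^ d * (d * n * ENNReal.ofReal τ))) := by
          rw [Finset.sum_const, nsmul_eq_mul, hBcard]
      _ = ENNReal.ofReal (2 * ((n + 1) ^ d) ^ 2 * d * n * τ) := by
          rw [ENNReal.ofReal_mul (by positivity), ENNReal.ofReal_mul (by positivity),
            ENNReal.ofReal_mul (by positivity), ENNReal.ofReal_mul (by positivity),
            ENNReal.ofReal_pow (by positivity), ENNReal.ofReal_pow (by positivity),
            ENNReal.ofReal_add (by positivity) (by positivity), ENNReal.ofReal_natCast,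
            ENNReal.ofReal_natCast, ENNReal.ofReal_one, ENNReal.ofReal_ofNat]
          ring
      _ ≤ _ := le_rfl
  have hg1 : ∀ x, (g x).toReal ≤ 1 := by
    intro x
    have : g x ≤ 1 := by
      rw [← hpart x]
      refine ENNReal.tsum_le_tsum fun k => ?_
      exact mul_le_of_le_one_left (by simp) (ENNReal.ofReal_le_one.2 (hp1 k))
    exact ENNReal.toReal_le_of_le_ofReal zero_le_one (by simpa using this)
  have hnn : ∀ x, 0 ≤ Real.negMulLog (g x).toReal := fun x =>
    Real.negMulLog_nonneg ENNReal.toReal_nonneg (hg1 x)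
  have hmeas : Measurable fun x => Real.negMulLog (g x).toReal :=
    Real.continuous_negMulLog.measurable.comp hgm.ennreal_toReal
  have hlow : ENNReal.ofReal (∑' k, Real.negMulLog (p k)) ≤
      ∫⁻ x, ENNReal.ofReal (Real.negMulLog (g x).toReal) := by
    rw [← hφint]
    exact lintegral_mono fun x => (hpt x).1
  have hup : ∫⁻ x, ENNReal.ofReal (Real.negMulLog (g x).toReal) ≤
      ENNReal.ofReal (∑' k, Real.negMulLog (p k) + 2 * ((n + 1) ^ d) ^ 2 * d * n * τ) := by
    rw [ENNReal.ofReal_add (tsum_nonneg hη0) (by positivity), ← hφint]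
    refine (lintegral_mono fun x => (hpt x).2).trans ?_
    rw [lintegral_add_left (Measurable.tsum fun k => (hshift k).const_mul _)]
    gcongr
  have hintble : Integrable fun x => Real.negMulLog (g x).toReal := by
    refine ⟨hmeas.aestronglyMeasurable, ?_⟩
    rw [hasFiniteIntegral_iff_ofReal (Filter.Eventually.of_forall hnn)]
    exact hup.trans_lt ENNReal.ofReal_lt_top
  have hH0 : 0 ≤ ∑' k, Real.negMulLog (p k) := tsum_nonneg hη0
  refine ⟨hintble, ?_, ?_⟩
  · rw [integral_eq_lintegral_of_nonneg_ae (Filter.Eventually.of_forall hnn)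
      hmeas.aestronglyMeasurable]
    rw [← ENNReal.ofReal_le_iff_le_toReal (hup.trans_lt ENNReal.ofReal_lt_top).ne]
    exact hlow
  · rw [integral_eq_lintegral_of_nonneg_ae (Filter.Eventually.of_forall hnn)
      hmeas.aestronglyMeasurable]
    exact ENNReal.toReal_le_of_le_ofReal (by positivity) hup

end Smoothing

/-! ### The density of a sum with one uniform summand. -/

section Density

variable {d : ℕ}

theorem measurable_castVec : Measurable (castVec (d := d)) := measurable_of_countable _

/-- The density of `W + U` where `W` has law `ν` and `U` is uniform on the unit cube. -/
noncomputable def cubeConv (ν : Measure (Fin d → ℝ)) (x : Fin d → ℝ) : ENNReal :=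
  ν {w | floorVec (x - w) = 0}

theorem measurableSet_floorVec_sub :
    MeasurableSet {q : (Fin d → ℝ) × (Fin d → ℝ) | floorVec (q.1 - q.2) = 0} :=
  (measurable_floorVec.comp (measurable_fst.sub measurable_snd)) (measurableSet_singleton 0)

theorem measurable_cubeConv (ν : Measure (Fin d → ℝ)) [SFinite ν] : Measurable (cubeConv ν) :=
  measurable_measure_prodMk_left measurableSet_floorVec_sub

theorem volume_floorVec_eq_zero : volume {x : Fin d → ℝ | floorVec x = 0} = 1 := by
  have : {x : Fin d → ℝ | floorVec x = 0} = Set.pi Set.univ fun _ => Set.Ico (0 : ℝ) 1 := by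
    ext x
    simp [floorVec, funext_iff, Int.floor_eq_iff]
  rw [this, Real.volume_pi_Ico]
  simp

theorem restrict_Icc_eq :
    (volume : Measure (Fin d → ℝ)).restrict (Set.Icc 0 1) =
      volume.restrict {x | floorVec x = 0} := by
  have : {x : Fin d → ℝ | floorVec x = 0} = Set.pi Set.univ fun _ => Set.Ico (0 : ℝ) 1 := by
    ext x
    simp [floorVec, funext_iff, Int.floor_eq_iff]
  rw [this]
  exact (Measure.restrict_congr_set (Measure.univ_pi_Ico_ae_eq_Icc (f := fun _ => 0)
    (g := fun _ => 1))).symm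

/-- Integrating out the uniform variable in the law of `c + W + U`. -/
theorem lintegral_add_uniform (ν : Measure (Fin d → ℝ)) [SFinite ν] (c : Fin d → ℝ)
    {A : Set (Fin d → ℝ)} (hA : MeasurableSet A) :
    ∫⁻ w, ∫⁻ v in {x | floorVec x = 0}, A.indicator 1 (c + (w + v)) ∂volume ∂ν =
      ∫⁻ x in A, cubeConv ν (x - c) := by
  have hQ : MeasurableSet {x : Fin d → ℝ | floorVec x = 0} :=
    measurable_floorVec (measurableSet_singleton 0)
  have h1 : ∀ w, ∫⁻ v in {x | floorVec x = 0}, A.indicator (1 : (Fin d → ℝ) → ENNReal) (c + (w + v)) =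
      ∫⁻ x, A.indicator 1 x *
        ({q : (Fin d → ℝ) × (Fin d → ℝ) | floorVec (q.1 - q.2) = 0}.indicator 1 (x - c, w)) := by
    intro w
    rw [← lintegral_indicator hQ,
      ← lintegral_add_right_eq_self (fun x => A.indicator (1 : (Fin d → ℝ) → ENNReal) x * _) (c + w)]
    refine lintegral_congr fun v => ?_
    have h2 : v + (c + w) = c + (w + v) := by abel
    have h3 : c + (w + v) - c - w = v := by abel
    simp only [Set.indicator_apply, Set.mem_ofPred_eq, h2, h3, Pi.one_apply]
    split_ifs <;> simp
  have hm : Measurable fun q : (Fin d → ℝ) × (Fin d → ℝ) => A.indicator (1 : (Fin d → ℝ) → ENNReal) q.2 *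
        ({q : (Fin d → ℝ) × (Fin d → ℝ) | floorVec (q.1 - q.2) = 0}.indicator 1 (q.2 - c, q.1)) := by
    refine ((measurable_one.indicator hA).comp measurable_snd).mul
      ((measurable_one.indicator measurableSet_floorVec_sub).comp ?_)
    exact (measurable_snd.sub_const c).prodMk measurable_fst
  simp_rw [h1]
  rw [lintegral_lintegral_swap hm.aemeasurable, ← lintegral_indicator hA]
  refine lintegral_congr fun x => ?_
  by_cases hx : x ∈ A
  · simp only [Set.indicator_of_mem hx, Pi.one_apply, one_mul]
    have hset : MeasurableSet {w | floorVec (x - c - w) = 0} :=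
      (measurable_floorVec.comp (measurable_id.const_sub _)) (measurableSet_singleton 0)
    rw [cubeConv, ← lintegral_indicator_one hset]
    rfl
  · simp [Set.indicator_of_notMem hx]

theorem lintegral_cubeConv (ν : Measure (Fin d → ℝ)) [IsProbabilityMeasure ν] :
    ∫⁻ x, cubeConv ν x = 1 := by
  have h := lintegral_add_uniform ν 0 MeasurableSet.univ
  simp only [Set.indicator_univ, Pi.one_apply, lintegral_const, Measure.restrict_apply_univ,
    volume_floorVec_eq_zero, measure_univ, mul_one, Measure.restrict_univ, sub_zero] at h
  exact h.symm

/-- The unit cubes tile space: for each `w` exactly one lattice point `k` satisfies `floorVec (x -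
w) = k`. One uniform summand suffices, whatever the law `ν` of the others. -/
theorem tsum_cubeConv (ν : Measure (Fin d → ℝ)) [IsProbabilityMeasure ν] (x : Fin d → ℝ) :
    ∑' k, cubeConv ν (x - castVec k) = 1 := by
  have hm : Measurable fun w => floorVec (x - w) :=
    measurable_floorVec.comp (measurable_id.const_sub _)
  have h1 : ∀ k, cubeConv ν (x - castVec k) = ν.map (fun w => floorVec (x - w)) {k} := by
    intro k
    rw [cubeConv, Measure.map_apply hm (measurableSet_singleton k)]
    congr 1
    ext w
    simp only [Set.mem_ofPred_eq, Set.mem_preimage, Set.mem_singleton_iff, funext_iff]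
    refine forall_congr' fun i => ?_
    simp only [floorVec, Pi.sub_apply, castVec, Pi.zero_apply]
    rw [sub_right_comm, Int.floor_sub_intCast, sub_eq_zero]
  simp_rw [h1]
  have := lintegral_countable' (μ := ν.map (fun w => floorVec (x - w))) 1
  simp only [Pi.one_apply, one_mul, lintegral_one] at this
  rw [← this, Measure.map_apply hm MeasurableSet.univ]
  simp

theorem cubeConv_support {ν : Measure (Fin d → ℝ)} {n : ℕ}
    (hν : ∀ᵐ w ∂ν, ∀ i, 0 ≤ w i ∧ w i + 1 ≤ (n : ℝ)) {x : Fin d → ℝ} (hx : cubeConv ν x ≠ 0) (i : Fin d) :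
    0 ≤ x i ∧ x i ≤ n := by
  obtain ⟨w, hw, hw'⟩ := ((frequently_ae_iff.2 hx).and_eventually hν).exists
  have h1 := congrFun hw i
  simp only [floorVec, Pi.sub_apply, Pi.zero_apply, Int.floor_eq_zero_iff, Set.mem_Ico] at h1
  have := hw' i
  constructor <;> linarith [h1.1, h1.2, this.1, this.2]

end Density

/-! ### The law of the smoothed sum. -/

section RandomVectors

variable {Ω : Type*} [MeasurableSpace Ω] {P : Measure Ω} {d n : ℕ}

theorem map_uniform {V : Ω → Fin d → ℝ} (hV : pdf.IsUniform V (Set.Icc 0 1) P volume) :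
    P.map V = volume.restrict (Set.Icc 0 1) := by
  rw [pdf.IsUniform] at hV
  rw [hV, ProbabilityTheory.cond, Real.volume_Icc_pi]
  simp

/-- One uniform vector is set apart and integrated out last; the sum of the others only enters
through its law `ν`. -/
theorem map_smoothedSum [IsProbabilityMeasure P] (hn : 0 < n) {X : Fin n → Ω → Fin d → ℤ} {U : Fin n → Ω → Fin d → ℝ}
    (hX : ∀ i, Measurable (X i)) (hU : ∀ i, Measurable (U i)) (hUi : iIndepFun U P)
    (hUu : ∀ i, pdf.IsUniform (U i) (Set.Icc 0 1) P volume)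
    (hXU : IndepFun (fun ω i => X i ω) (fun ω i => U i ω) P) :
    P.map (smoothedSum X U) = volume.withDensity fun x => ∑' k,
      ENNReal.ofReal (pmf P (latticeSum X) k) *
        cubeConv (P.map fun ω => ∑ i ∈ Finset.univ.erase ⟨0, hn⟩, U i ω) (x - castVec k) := by
  set i₀ : Fin n := ⟨0, hn⟩
  set W : Ω → Fin d → ℝ := fun ω => ∑ i ∈ Finset.univ.erase i₀, U i ω with hW
  have hWm : Measurable W := Finset.measurable_fun_sum _ fun i _ => hU i
  have hSm : Measurable (latticeSum X) := Finset.measurable_fun_sum _ fun i _ => hX i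
  set ν := P.map W with hν
  have : IsProbabilityMeasure ν := Measure.isProbabilityMeasure_map hWm.aemeasurable
  have hind1 : IndepFun (latticeSum X) (fun ω => (W ω, U i₀ ω)) P := by
    refine hXU.comp (φ := fun x => ∑ i, x i)
      (ψ := fun y : Fin n → Fin d → ℝ => (∑ i ∈ Finset.univ.erase i₀, y i, y i₀)) ?_ ?_
    · exact Finset.measurable_fun_sum _ fun i _ => measurable_pi_apply i
    · exact (Finset.measurable_fun_sum _ fun i _ => measurable_pi_apply i).prodMk
        (measurable_pi_apply i₀)
  have hind2 : IndepFun W (U i₀) P := by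
    have := hUi.indepFun_finsetSum_of_notMem hU (Finset.notMem_erase i₀ Finset.univ)
    convert this using 1
    ext ω
    simp [hW]
  have hlaw : P.map (fun ω => (latticeSum X ω, (W ω, U i₀ ω))) =
      (P.map (latticeSum X)).prod (ν.prod (volume.restrict {x | floorVec x = 0})) := by
    rw [(indepFun_iff_map_prod_eq_prod_map_map hSm.aemeasurable
      (hWm.prodMk (hU i₀)).aemeasurable).1 hind1,
      (indepFun_iff_map_prod_eq_prod_map_map hWm.aemeasurable (hU i₀).aemeasurable).1 hind2,
      map_uniform (hUu i₀), restrict_Icc_eq]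
  have hY : smoothedSum X U = (fun q : (Fin d → ℤ) × ((Fin d → ℝ) × (Fin d → ℝ)) =>
      castVec q.1 + (q.2.1 + q.2.2)) ∘ fun ω => (latticeSum X ω, (W ω, U i₀ ω)) := by
    ext ω j
    simp only [smoothedSum, Function.comp, Pi.add_apply, castVec, hW, Finset.sum_apply]
    rw [Finset.sum_erase_add _ _ (Finset.mem_univ i₀)]
  have hadd : Measurable fun q : (Fin d → ℤ) × ((Fin d → ℝ) × (Fin d → ℝ)) =>
      castVec q.1 + (q.2.1 + q.2.2) :=
    (measurable_castVec.comp measurable_fst).add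
      ((measurable_fst.comp measurable_snd).add (measurable_snd.comp measurable_snd))
  have hshift : ∀ k : Fin d → ℤ, Measurable fun x => cubeConv ν (x - castVec k) := fun k =>
    (measurable_cubeConv ν).comp (measurable_id.sub_const _)
  rw [hY, ← Measure.map_map hadd (hSm.prodMk (hWm.prodMk (hU i₀))), hlaw]
  ext A hA
  rw [withDensity_apply _ hA, lintegral_tsum fun k => ((hshift k).const_mul _).aemeasurable,
    ← lintegral_indicator_one hA, lintegral_map (measurable_one.indicator hA) hadd,
    lintegral_prod (fun q : (Fin d → ℤ) × ((Fin d → ℝ) × (Fin d → ℝ)) =>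
      A.indicator 1 (castVec q.1 + (q.2.1 + q.2.2)))
      ((measurable_one.indicator hA).comp hadd).aemeasurable, lintegral_countable']
  refine tsum_congr fun k => ?_
  rw [lintegral_const_mul _ (hshift k), mul_comm]
  congr 1
  · simp [pmf, measureReal_def]
  · rw [← lintegral_add_uniform ν (castVec k) hA,
      lintegral_prod (fun q : (Fin d → ℝ) × (Fin d → ℝ) => A.indicator 1 (castVec k + (q.1 + q.2)))]
    exact ((measurable_one.indicator hA).comp (hadd.comp
      (measurable_const.prodMk measurable_id))).aemeasurable

/-- Only `n - 1` uniforms remain, so there is room for one more unit cube inside `[0, n]^d`. -/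
theorem ae_sum_uniform (hn : 0 < n) {U : Fin n → Ω → Fin d → ℝ} (hU : ∀ i, Measurable (U i))
    (hUu : ∀ i, pdf.IsUniform (U i) (Set.Icc 0 1) P volume) :
    ∀ᵐ w ∂(P.map fun ω => ∑ i ∈ Finset.univ.erase (⟨0, hn⟩ : Fin n), U i ω),
      ∀ j, 0 ≤ w j ∧ w j + 1 ≤ (n : ℝ) := by
  have hWm : Measurable fun ω => ∑ i ∈ Finset.univ.erase (⟨0, hn⟩ : Fin n), U i ω :=
    Finset.measurable_fun_sum _ fun i _ => hU i
  have hset : MeasurableSet {w : Fin d → ℝ | ∀ j, 0 ≤ w j ∧ w j + 1 ≤ (n : ℝ)} := by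
    measurability
  rw [ae_map_iff hWm.aemeasurable hset]
  have h1 : ∀ i, ∀ᵐ ω ∂P, U i ω ∈ Set.Icc (0 : Fin d → ℝ) 1 := by
    intro i
    refine ae_of_ae_map (hU i).aemeasurable (p := fun y => y ∈ Set.Icc (0 : Fin d → ℝ) 1) ?_
    rw [map_uniform (hUu i)]
    exact ae_restrict_mem measurableSet_Icc
  filter_upwards [ae_all_iff.2 h1] with ω hω j
  rw [Finset.sum_apply]
  refine ⟨Finset.sum_nonneg fun i _ => (hω i).1 j, ?_⟩
  have h2 : ∑ i ∈ Finset.univ.erase (⟨0, hn⟩ : Fin n), U i ω j ≤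
      ∑ _i ∈ Finset.univ.erase (⟨0, hn⟩ : Fin n), (1 : ℝ) :=
    Finset.sum_le_sum fun i _ => (hω i).2 j
  rw [Finset.sum_const, Finset.card_erase_of_mem (Finset.mem_univ _), Finset.card_univ,
    Fintype.card_fin, nsmul_eq_mul, mul_one, Nat.cast_sub hn] at h2
  push_cast at h2
  linarith

end RandomVectors

/-! ### Moments and entropy of lattice mass functions. -/

section MassFunction

variable {Ω : Type*} [MeasurableSpace Ω] {P : Measure Ω} {d : ℕ} {X : Ω → Fin d → ℤ}

theorem pmf_nonneg (k : Fin d → ℤ) : 0 ≤ pmf P X k := measureReal_nonneg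

theorem pmf_le_one [IsProbabilityMeasure P] (hX : Measurable X) (k : Fin d → ℤ) :
    pmf P X k ≤ 1 := by
  have : IsProbabilityMeasure (P.map X) := Measure.isProbabilityMeasure_map hX.aemeasurable
  exact measureReal_le_one

theorem ofReal_pmf [IsProbabilityMeasure P] (hX : Measurable X) (k : Fin d → ℤ) :
    ENNReal.ofReal (pmf P X k) = P.map X {k} := by
  have : IsProbabilityMeasure (P.map X) := Measure.isProbabilityMeasure_map hX.aemeasurable
  rw [pmf, ofReal_measureReal]

theorem hasSum_mul_pmf [IsProbabilityMeasure P] (hX : Measurable X) {g : (Fin d → ℤ) → ℝ}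
    (hg : Integrable (fun ω => g (X ω)) P) :
    HasSum (fun k => g k * pmf P X k) (∫ ω, g (X ω) ∂P) := by
  have hg' : Integrable g (P.map X) :=
    (integrable_map_measure (measurable_of_countable g).aestronglyMeasurable hX.aemeasurable).2 hg
  rw [← integral_map hX.aemeasurable (measurable_of_countable g).aestronglyMeasurable]
  rw [← Measure.sum_smul_dirac (P.map X)] at hg' ⊢
  have := hasSum_integral_measure hg'
  refine this.congr_fun fun k => ?_
  rw [integral_smul_measure, integral_dirac, smul_eq_mul, mul_comm, pmf, measureReal_def]

theorem hasSum_pmf [IsProbabilityMeasure P] (hX : Measurable X) : HasSum (pmf P X) 1 := by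
  simpa using hasSum_mul_pmf (P := P) hX (g := fun _ => 1) (by simp)

theorem discreteCovMatrix_pmf [IsProbabilityMeasure P] (hX : Measurable X)
    (hL : ∀ j, MemLp (fun ω => (X ω j : ℝ)) 2 P) (i j : Fin d) :
    discreteCovMatrix (pmf P X) i j =
      cov[fun ω => (X ω i : ℝ), fun ω => (X ω j : ℝ); P] := by
  have h1 : ∀ j, ∑' k : Fin d → ℤ, (k j : ℝ) * pmf P X k = ∫ ω, (X ω j : ℝ) ∂P := fun j =>
    (hasSum_mul_pmf hX (g := fun k => (k j : ℝ)) ((hL j).integrable one_le_two)).tsum_eq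
  have h2 : ∑' k : Fin d → ℤ, (k i : ℝ) * (k j : ℝ) * pmf P X k =
      ∫ ω, (X ω i : ℝ) * (X ω j : ℝ) ∂P :=
    (hasSum_mul_pmf hX (g := fun k => (k i : ℝ) * (k j : ℝ))
      ((hL i).integrable_mul (hL j))).tsum_eq
  rw [covariance_eq_sub (hL i) (hL j), discreteCovMatrix, Matrix.of_apply,
    (hasSum_pmf hX).tsum_eq, h1, h1, h2]
  simp

/-- Half of the exponential rate is spent to absorb the quadratic weight. -/
theorem sq_mul_exp_le {a : ℝ} (ha : 0 < a) (t : ℝ) :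
    t ^ 2 * Real.exp (-(a * |t|)) ≤ 8 / a ^ 2 * Real.exp (-(a / 2 * |t|)) := by
  have h1 : (a / 2 * |t|) ^ 2 / 2 ≤ Real.exp (a / 2 * |t|) := by
    have := Real.quadratic_le_exp_of_nonneg (x := a / 2 * |t|) (by positivity)
    have h0 : 0 ≤ a / 2 * |t| := by positivity
    linarith
  have h2 : t ^ 2 ≤ 8 / a ^ 2 * Real.exp (a / 2 * |t|) := by
    rw [← sq_abs t]
    calc |t| ^ 2 = 8 / a ^ 2 * ((a / 2 * |t|) ^ 2 / 2) := by field_simp; norm_num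
      _ ≤ _ := by gcongr
  calc t ^ 2 * Real.exp (-(a * |t|))
      ≤ 8 / a ^ 2 * Real.exp (a / 2 * |t|) * Real.exp (-(a * |t|)) := by gcongr
    _ = _ := by rw [mul_assoc, ← Real.exp_add]; ring_nf

/-- Second moments of a mass function with exponential decay. -/
theorem tsum_sq_mul_le_of_decay {A b s : ℝ} (hA : 0 < A) (hb : 0 < b) (hs : 1 ≤ s)
    {c : Fin d → ℝ} {p : (Fin d → ℤ) → ℝ} (hp : HasDecay A b s c p) (j : Fin d) :
    ∑' k : Fin d → ℤ, ENNReal.ofReal ((k j - c j) ^ 2 * p k) ≤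
      ENNReal.ofReal (8 * A * expSumConst (b / 2) ^ d / b ^ 2 * s ^ 2) := by
  have hs0 : 0 < s := by linarith
  have hpt : ∀ k : Fin d → ℤ, (k j - c j) ^ 2 * p k ≤
      A / s ^ d * (8 / (b / s) ^ 2) * ∏ i, Real.exp (-(b / 2 / s * |k i - c i|)) := by
    intro k
    have h1 : (k j - c j) ^ 2 * ∏ i, Real.exp (-(b / s * |k i - c i|)) ≤
        8 / (b / s) ^ 2 * ∏ i, Real.exp (-(b / 2 / s * |k i - c i|)) := by
      rw [Fintype.prod_eq_mul_prod_subtype_ne _ j,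
        Fintype.prod_eq_mul_prod_subtype_ne (fun i => Real.exp (-(b / 2 / s * |k i - c i|))) j,
        ← mul_assoc, ← mul_assoc]
      have h2 := sq_mul_exp_le (a := b / s) (by positivity) (k j - c j)
      rw [show b / s / 2 = b / 2 / s by ring] at h2
      have h3 : b / 2 / s ≤ b / s := by gcongr; linarith
      refine mul_le_mul h2 ?_ (by positivity) (by positivity)
      gcongr
    calc (k j - c j) ^ 2 * p k
        ≤ (k j - c j) ^ 2 * (A / s ^ d * ∏ i, Real.exp (-(b / s * |k i - c i|))) := by
          gcongr
          exact hp k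
      _ = A / s ^ d * ((k j - c j) ^ 2 * ∏ i, Real.exp (-(b / s * |k i - c i|))) := by ring
      _ ≤ A / s ^ d * (8 / (b / s) ^ 2 * ∏ i, Real.exp (-(b / 2 / s * |k i - c i|))) := by gcongr
      _ = _ := by ring
  calc _ ≤ ∑' k : Fin d → ℤ, ENNReal.ofReal (A / s ^ d * (8 / (b / s) ^ 2)) *
        ENNReal.ofReal (∏ i, Real.exp (-(b / 2 / s * |k i - c i|))) :=
        ENNReal.tsum_le_tsum fun k => (ENNReal.ofReal_le_ofReal (hpt k)).trans_eq
          (ENNReal.ofReal_mul (by positivity))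
    _ ≤ ENNReal.ofReal (A / s ^ d * (8 / (b / s) ^ 2)) *
        ENNReal.ofReal ((expSumConst (b / 2) * s) ^ d) := by
        rw [ENNReal.tsum_mul_left]
        gcongr
        simpa using tsum_prod_exp_le (b := b / 2) (by positivity) hs c
    _ = _ := by
        rw [← ENNReal.ofReal_mul (by positivity)]
        congr 1
        rw [mul_pow]
        field_simp

/-- The variance is at most the second moment about any point, here the centre of decay `c`. -/
theorem memLp_and_variance_le_of_decay [IsProbabilityMeasure P] (hX : Measurable X) {A b s : ℝ}
    (hA : 0 < A) (hb : 0 < b) (hs : 1 ≤ s) {c : Fin d → ℝ} (hp : HasDecay A b s c (pmf P X))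
    (j : Fin d) : MemLp (fun ω => (X ω j : ℝ)) 2 P ∧ Var[fun ω => (X ω j : ℝ); P] ≤
      8 * A * expSumConst (b / 2) ^ d / b ^ 2 * s ^ 2 := by
  have hm : Measurable fun ω => (X ω j : ℝ) :=
    (measurable_of_countable fun k : Fin d → ℤ => (k j : ℝ)).comp hX
  have hlint : ∫⁻ ω, ENNReal.ofReal (((X ω j : ℝ) - c j) ^ 2) ∂P ≤
      ENNReal.ofReal (8 * A * expSumConst (b / 2) ^ d / b ^ 2 * s ^ 2) := by
    rw [← lintegral_map (f := fun k : Fin d → ℤ => ENNReal.ofReal (((k j : ℝ) - c j) ^ 2))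
      (measurable_of_countable _) hX, lintegral_countable']
    refine le_trans (le_of_eq (tsum_congr fun k => ?_)) (tsum_sq_mul_le_of_decay hA hb hs hp j)
    rw [← ofReal_pmf hX, ENNReal.ofReal_mul (sq_nonneg _)]
  have hintg : Integrable (fun ω => ((X ω j : ℝ) - c j) ^ 2) P := by
    refine ⟨((hm.sub_const _).pow_const 2).aestronglyMeasurable, ?_⟩
    rw [hasFiniteIntegral_iff_ofReal (Filter.Eventually.of_forall fun ω => sq_nonneg _)]
    exact hlint.trans_lt ENNReal.ofReal_lt_top
  have hL : MemLp (fun ω => (X ω j : ℝ) - c j) 2 P :=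
    (memLp_two_iff_integrable_sq (hm.sub_const _).aestronglyMeasurable).2 hintg
  refine ⟨?_, ?_⟩
  · have := hL.add (memLp_const (c j))
    refine this.ae_eq (Filter.Eventually.of_forall fun ω => ?_)
    simp
  · rw [← variance_sub_const hm.aestronglyMeasurable (c j)]
    refine (variance_le_expectation_sq (hm.sub_const _).aestronglyMeasurable).trans ?_
    have h1 : ∫ ω, ((X ω j : ℝ) - c j) ^ 2 ∂P ≤
        8 * A * expSumConst (b / 2) ^ d / b ^ 2 * s ^ 2 := by
      rw [integral_eq_lintegral_of_nonneg_ae (Filter.Eventually.of_forall fun ω => sq_nonneg _)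
        hintg.1]
      have := expSumConst_pos (b := b / 2) (by positivity)
      exact ENNReal.toReal_le_of_le_ofReal (by positivity) hlint
    simpa using h1

/-- Comparison with the exponential weights: the entropy is at most `d * log s + O(1)`. -/
theorem entropy_le [IsProbabilityMeasure P] (hX : Measurable X) {s V : ℝ} (hs : 1 ≤ s)
    (hL : ∀ j, MemLp (fun ω => (X ω j : ℝ)) 2 P)
    (hV : ∀ j, Var[fun ω => (X ω j : ℝ); P] ≤ V * s ^ 2) :
    HasShannonEntropy P X ∧
      shannonEntropy P X ≤ d * Real.log s + (d + d * V + expSumConst 1 ^ d) := by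
  have hs0 : 0 < s := by linarith
  set μ : Fin d → ℝ := fun j => ∫ ω, (X ω j : ℝ) ∂P with hμ
  set q := pmf P X with hq
  -- The reference weights in Gibbs' inequality are left unnormalised; their total mass is bounded
  -- independently of `s` and appears as the term `expSumConst 1 ^ d`.
  set r : (Fin d → ℤ) → ℝ := fun k => (s ^ d)⁻¹ * ∏ i, Real.exp (-(1 / s * |k i - μ i|)) with hr
  have hr0 : ∀ k, 0 < r k := fun k => by
    have : 0 < ∏ i, Real.exp (-(1 / s * |k i - μ i|)) :=
      Finset.prod_pos fun i _ => Real.exp_pos _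
    positivity
  have hlogr : ∀ k, -Real.log (r k) = d * Real.log s + ∑ i, 1 / s * |k i - μ i| := by
    intro k
    rw [hr]
    simp only
    rw [← Real.exp_sum, Real.log_mul (by positivity) (Real.exp_pos _).ne', Real.log_exp,
      Real.log_inv, Real.log_pow, Finset.sum_neg_distrib]
    ring
  have hsq : ∀ j, HasSum (fun k : Fin d → ℤ => (k j - μ j) ^ 2 * q k)
      (Var[fun ω => (X ω j : ℝ); P]) := by
    intro j
    have hintg : Integrable (fun ω => ((X ω j : ℝ) - μ j) ^ 2) P :=
      ((hL j).sub (memLp_const (μ j))).integrable_sq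
    rw [variance_eq_integral (hL j).aemeasurable]
    exact hasSum_mul_pmf hX (g := fun k => (k j - μ j) ^ 2) hintg
  have hrsum : Summable r ∧ ∑' k, r k ≤ expSumConst 1 ^ d := by
    have h1 : ∑' k, ENNReal.ofReal (r k) ≤ ENNReal.ofReal (expSumConst 1 ^ d) := by
      rw [hr]
      simp_rw [fun k : Fin d → ℤ => ENNReal.ofReal_mul
        (q := ∏ i, Real.exp (-(1 / s * |k i - μ i|))) (inv_nonneg.2 (pow_nonneg hs0.le d))]
      rw [ENNReal.tsum_mul_left]
      have h2 := tsum_prod_exp_le (b := 1) one_pos hs μ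
      rw [Fintype.card_fin] at h2
      refine (mul_le_mul_right h2 _).trans_eq ?_
      rw [← ENNReal.ofReal_mul (by positivity), mul_pow]
      congr 1
      field_simp
    have h3 : Summable r := by
      have := ENNReal.summable_toReal (h1.trans_lt ENNReal.ofReal_lt_top).ne
      exact this.congr fun k => by rw [ENNReal.toReal_ofReal (hr0 k).le]
    refine ⟨h3, ?_⟩
    rw [← ENNReal.ofReal_tsum_of_nonneg (fun k => (hr0 k).le) h3] at h1
    have := expSumConst_pos one_pos
    exact (ENNReal.ofReal_le_ofReal_iff (by positivity)).1 h1
  have hpt : ∀ k, Real.negMulLog (q k) ≤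
      (d * Real.log s + d) * q k + ∑ j, (s ^ 2)⁻¹ * ((k j - μ j) ^ 2 * q k) + r k := by
    intro k
    have hq0 : 0 ≤ q k := pmf_nonneg k
    have h1 : Real.negMulLog (q k) ≤ q k * -Real.log (r k) + r k := by
      rcases hq0.eq_or_lt with h0 | h0
      · rw [← h0, Real.negMulLog_zero, zero_mul, zero_add]
        exact (hr0 k).le
      · have h2 : Real.log (r k / q k) ≤ r k / q k - 1 :=
          Real.log_le_sub_one_of_pos (div_pos (hr0 k) h0)
        rw [Real.log_div (hr0 k).ne' h0.ne'] at h2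
        have h3 := mul_le_mul_of_nonneg_left h2 h0.le
        have h4 : q k * (r k / q k - 1) = r k - q k := by field_simp
        rw [h4] at h3
        rw [Real.negMulLog]
        linarith
    refine h1.trans ?_
    gcongr
    have hfac : ∑ j, (s ^ 2)⁻¹ * (((k j : ℝ) - μ j) ^ 2 * q k) =
        (∑ j, (s ^ 2)⁻¹ * ((k j : ℝ) - μ j) ^ 2) * q k := by
      rw [Finset.sum_mul]
      exact Finset.sum_congr rfl fun j _ => by ring
    rw [hlogr, hfac, mul_comm (q k), ← add_mul]
    refine mul_le_mul_of_nonneg_right ?_ hq0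
    -- `t ≤ 1 + t ^ 2` trades the first absolute moment for the variance.
    have h5 : ∀ i ∈ Finset.univ, 1 / s * |(k i : ℝ) - μ i| ≤ 1 + (s ^ 2)⁻¹ * (k i - μ i) ^ 2 := by
      intro i _
      have : (s ^ 2)⁻¹ * ((k i : ℝ) - μ i) ^ 2 = (1 / s * |(k i : ℝ) - μ i|) ^ 2 := by
        rw [mul_pow, sq_abs]; ring
      rw [this]
      nlinarith [sq_nonneg (1 / s * |(k i : ℝ) - μ i| - 1), sq_nonneg (1 / s * |(k i : ℝ) - μ i|)]
    have h6 := Finset.sum_le_sum h5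
    rw [Finset.sum_add_distrib] at h6
    simp only [Finset.sum_const, Finset.card_univ, Fintype.card_fin, nsmul_eq_mul, mul_one] at h6
    linarith
  have hub : HasSum (fun k : Fin d → ℤ => (d * Real.log s + d) * q k +
      ∑ j, (s ^ 2)⁻¹ * ((k j - μ j) ^ 2 * q k) + r k)
      ((d * Real.log s + d) * 1 + ∑ j, (s ^ 2)⁻¹ * Var[fun ω => (X ω j : ℝ); P] + ∑' k, r k) :=
    (((hasSum_pmf hX).mul_left _).add (hasSum_sum fun j _ => (hsq j).mul_left _)).add
      hrsum.1.hasSum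
  have hsummable : Summable fun k => Real.negMulLog (q k) :=
    Summable.of_nonneg_of_le
      (fun k => Real.negMulLog_nonneg (pmf_nonneg k) (pmf_le_one hX k)) hpt hub.summable
  refine ⟨hsummable, ?_⟩
  have h1 := hsummable.tsum_le_tsum hpt hub.summable
  rw [hub.tsum_eq] at h1
  have h2 : ∑ j, (s ^ 2)⁻¹ * Var[fun ω => (X ω j : ℝ); P] ≤ d * V := by
    calc _ ≤ ∑ _j : Fin d, V := Finset.sum_le_sum fun j _ => by
          rw [inv_mul_le_iff₀ (by positivity)]
          linarith [hV j]
      _ = _ := by simp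
  rw [shannonEntropy]
  linarith [hrsum.2]

theorem one_le_entropy [IsProbabilityMeasure P] (hX : Measurable X) (hH : HasShannonEntropy P X)
    (hq : ∀ k, pmf P X k ≤ Real.exp (-1)) : 1 ≤ shannonEntropy P X := by
  rw [← (hasSum_pmf (P := P) hX).tsum_eq]
  refine (hasSum_pmf hX).summable.tsum_le_tsum (fun k => ?_) hH
  rcases (pmf_nonneg (P := P) (X := X) k).eq_or_lt with h | h
  · rw [← h]; simp
  · have : Real.log (pmf P X k) ≤ -1 := by
      rw [← Real.log_exp (-1)]
      exact Real.log_le_log h (hq k)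
    rw [Real.negMulLog]
    nlinarith

end MassFunction

/-! ### Determinant and scale of a covariance matrix. -/

section Determinant

open Matrix

variable {d : ℕ}

/-- Each eigenvalue lies between `L / d` and the trace. The `d` in the lower bound converts
Euclidean unit vectors to the sup norm, in which `hlow` is stated. -/
theorem det_bounds {A : Matrix (Fin d) (Fin d) ℝ} (hA : A.IsHermitian) {L V : ℝ} (hL : 0 ≤ L)
    (hlow : ∀ θ : Fin d → ℝ, L * ‖θ‖ ^ 2 ≤ ∑ i, ∑ j, θ i * θ j * A i j) (hV : ∀ i, A i i ≤ V) :
    (L / d) ^ d ≤ A.det ∧ A.det ≤ (d * V) ^ d := by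
  rcases Nat.eq_zero_or_pos d with rfl | hd
  · simp
  have hd' : (0 : ℝ) < d := by exact_mod_cast hd
  have hev : ∀ i, L / d ≤ hA.eigenvalues i := by
    intro i
    set v : Fin d → ℝ := ⇑(hA.eigenvectorBasis i) with hv
    have h1 : hA.eigenvalues i = ∑ a, ∑ b, v a * v b * A a b := by
      rw [hA.eigenvalues_eq]
      simp only [dotProduct, mulVec, ← hv, Pi.star_apply, star_trivial, RCLike.re_to_real]
      refine Finset.sum_congr rfl fun a _ => ?_
      rw [Finset.mul_sum]
      exact Finset.sum_congr rfl fun b _ => by ring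
    have h2 : ∑ a, v a ^ 2 = 1 := by
      have := hA.eigenvectorBasis.orthonormal.1 i
      rw [EuclideanSpace.norm_eq, Real.sqrt_eq_one] at this
      simpa [hv] using this
    have h3 : (1 : ℝ) ≤ d * ‖v‖ ^ 2 := by
      rw [← h2]
      calc ∑ a, v a ^ 2 ≤ ∑ _a : Fin d, ‖v‖ ^ 2 := Finset.sum_le_sum fun a _ => by
            rw [← sq_abs]
            exact pow_le_pow_left₀ (abs_nonneg _) (norm_le_pi_norm v a) 2
        _ = _ := by simp
    rw [h1]
    refine le_trans ?_ (hlow v)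
    rw [div_le_iff₀ hd']
    nlinarith
  have hev0 : ∀ i, 0 ≤ hA.eigenvalues i := fun i => le_trans (by positivity) (hev i)
  have htr : ∀ i, hA.eigenvalues i ≤ d * V := by
    intro i
    have h1 : A.trace = ∑ i, hA.eigenvalues i := by
      simpa using hA.trace_eq_sum_eigenvalues
    calc hA.eigenvalues i ≤ ∑ i, hA.eigenvalues i :=
          Finset.single_le_sum (fun i _ => hev0 i) (Finset.mem_univ i)
      _ = ∑ i, A i i := by rw [← h1]; rfl
      _ ≤ ∑ _i : Fin d, V := Finset.sum_le_sum fun i _ => hV i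
      _ = _ := by simp
  have hdet : A.det = ∏ i, hA.eigenvalues i := by
    simpa using hA.det_eq_prod_eigenvalues
  have hc : ∀ x : ℝ, x ^ d = ∏ _i : Fin d, x := fun x => by simp
  rw [hdet, hc, hc]
  exact ⟨Finset.prod_le_prod (fun i _ => by positivity) fun i _ => hev i,
    Finset.prod_le_prod (fun i _ => hev0 i) fun i _ => htr i⟩

theorem scale_pow (hd : 0 < d) {t : ℝ} (ht : 0 ≤ t) :
    ((t ^ 2) ^ d) ^ (1 / (2 * (d : ℝ))) = t := by
  have hd' : (0 : ℝ) < d := by exact_mod_cast hd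
  rw [← pow_mul, ← Real.rpow_natCast, ← Real.rpow_mul ht]
  push_cast
  rw [mul_one_div_cancel (by positivity), Real.rpow_one]

theorem le_scale_of_pow_le_det (hd : 0 < d) {A : Matrix (Fin d) (Fin d) ℝ} {t : ℝ} (ht : 0 ≤ t)
    (h : (t ^ 2) ^ d ≤ A.det) : t ≤ scale A := by
  rw [scale, ← scale_pow hd ht]
  exact Real.rpow_le_rpow (by positivity) h (by positivity)

theorem scale_le_of_det_le_pow (hd : 0 < d) {A : Matrix (Fin d) (Fin d) ℝ} {t : ℝ} (ht : 0 ≤ t)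
    (h0 : 0 ≤ A.det) (h : A.det ≤ (t ^ 2) ^ d) : scale A ≤ t := by
  rw [scale, ← scale_pow hd ht]
  exact Real.rpow_le_rpow h0 h (by positivity)

end Determinant

/-! ### Small mass of slabs and lower bounds for variances. -/

section Slab

variable {Ω : Type*} [MeasurableSpace Ω] {P : Measure Ω} {d : ℕ} {X : Ω → Fin d → ℤ}

theorem tsum_indicator_interval_le {ψ : ℤ → ENNReal} {B r h : ℝ} (hh : 0 ≤ h)
    (hψ : ∀ t, ψ t ≤ ENNReal.ofReal B) (h0 : ∀ t : ℤ, h ≤ |t - r| → ψ t = 0) :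
    ∑' t, ψ t ≤ ENNReal.ofReal ((2 * h + 1) * B) := by
  rw [tsum_eq_sum (s := Finset.Icc ⌈r - h⌉ ⌊r + h⌋)]
  · refine (Finset.sum_le_card_nsmul _ _ _ fun t _ => hψ t).trans ?_
    rw [nsmul_eq_mul, ENNReal.ofReal_mul (by positivity)]
    gcongr
    rw [← ENNReal.ofReal_natCast]
    refine ENNReal.ofReal_le_ofReal ?_
    rw [Int.card_Icc]
    have h1 := Int.floor_le (r + h)
    have h2 := Int.le_ceil (r - h)
    have h3 : ((⌊r + h⌋ + 1 - ⌈r - h⌉ : ℤ) : ℝ) ≤ 2 * h + 1 := by push_cast; linarith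
    rcases le_total 0 (⌊r + h⌋ + 1 - ⌈r - h⌉) with h4 | h4
    · calc (((⌊r + h⌋ + 1 - ⌈r - h⌉).toNat : ℕ) : ℝ)
          = (((⌊r + h⌋ + 1 - ⌈r - h⌉).toNat : ℤ) : ℝ) := by norm_cast
        _ = ((⌊r + h⌋ + 1 - ⌈r - h⌉ : ℤ) : ℝ) := by rw [Int.toNat_of_nonneg h4]
        _ ≤ _ := h3
    · rw [Int.toNat_of_nonpos h4]
      push_cast
      linarith
  · intro t ht
    apply h0
    by_contra! hlt
    rw [abs_lt] at hlt
    apply ht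
    rw [Finset.mem_Icc, Int.ceil_le, Int.le_floor]
    constructor <;> linarith [hlt.1, hlt.2]

/-- A random vector whose mass function decays on the scale `s` has small probability to lie in
a slab of width small compared to `s`. -/
theorem measure_slab_le [IsProbabilityMeasure P] (hX : Measurable X) {A b s : ℝ} (hA : 0 < A)
    (hb : 0 < b) (hs : 1 ≤ s) {c : Fin d → ℝ} (hp : HasDecay A b s c (pmf P X)) {θ : Fin d → ℝ}
    {i : Fin d} (hθ : θ i ≠ 0) (a : ℝ) {h : ℝ} (hh : 1 ≤ h) :
    P {ω | |∑ j, θ j * (X ω j : ℝ) - a| < h * |θ i|} ≤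
      ENNReal.ofReal (3 * h * A * expSumConst b ^ (d - 1) / s) := by
  classical
  have hs0 : 0 < s := by linarith
  set Bad : Set (Fin d → ℤ) := {k | |∑ j, θ j * (k j : ℝ) - a| < h * |θ i|} with hBad
  have h1 : P {ω | |∑ j, θ j * (X ω j : ℝ) - a| < h * |θ i|} =
      ∑' k, Bad.indicator (fun k => ENNReal.ofReal (pmf P X k)) k := by
    have h2 : {ω | |∑ j, θ j * (X ω j : ℝ) - a| < h * |θ i|} = X ⁻¹' Bad := rfl
    rw [h2, ← Measure.map_apply hX (Set.to_countable Bad).measurableSet,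
      ← lintegral_indicator_one (Set.to_countable Bad).measurableSet, lintegral_countable']
    refine tsum_congr fun k => ?_
    by_cases hk : k ∈ Bad <;> simp [hk, ofReal_pmf hX]
  rw [h1]
  refine (tsum_le_of_lines hb hs i c _ (β := (2 * h + 1) * (A / s ^ d)) (by positivity)
    fun k => ?_).trans (ENNReal.ofReal_le_ofReal ?_)
  · rw [mul_assoc]
    -- On the line in direction `i` through `k`, the slab is the interval of radius `h` about `r`,
    -- containing at most `2 * h + 1 ≤ 3 * h` integers.
    set r : ℝ := (a - ∑ j : {j // j ≠ i}, θ j * (k j : ℝ)) / θ i with hr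
    refine tsum_indicator_interval_le (r := r) (by linarith) (fun t => ?_)
      fun t ht => ?_
    · refine (Set.indicator_le_self _ _ _).trans (ENNReal.ofReal_le_ofReal ((hp _).trans ?_))
      gcongr
      exact prod_lineMk_exp_le (by positivity) c i k t
    · apply Set.indicator_of_notMem
      rw [hBad, Set.mem_ofPred_eq, not_lt]
      have h3 : ∑ j, θ j * (lineMk i k t j : ℝ) - a = (t - r) * θ i := by
        rw [Fintype.sum_eq_add_sum_subtype_ne _ i, lineMk_self]
        have : ∑ j : {j // j ≠ i}, θ j * (lineMk i k t j : ℝ) =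
            ∑ j : {j // j ≠ i}, θ j * (k j : ℝ) :=
          Finset.sum_congr rfl fun j _ => by rw [lineMk_of_ne j.2]
        rw [this, hr, sub_mul, div_mul_cancel₀ _ hθ]
        ring
      rw [h3, abs_mul]
      gcongr
  · have hd : 0 < d := i.pos
    have hC := expSumConst_pos hb
    obtain ⟨m, rfl⟩ : ∃ m, d = m + 1 := ⟨d - 1, by omega⟩
    rw [Nat.add_sub_cancel, mul_pow, pow_succ]
    calc (2 * h + 1) * (A / (s ^ m * s)) * (expSumConst b ^ m * s ^ m)
        = (2 * h + 1) * A * expSumConst b ^ m / s := by field_simp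
      _ ≤ _ := by gcongr; linarith

/-- Lower bound for the variance of the projections of a random vector whose mass function decays
on the scale `s`. -/
theorem le_covariance_of_decay [IsProbabilityMeasure P] (hX : Measurable X) {A b s δ : ℝ}
    (hA : 0 < A) (hb : 0 < b) (hs : 1 ≤ s) {c : Fin d → ℝ} (hp : HasDecay A b s c (pmf P X))
    (hL : ∀ j, MemLp (fun ω => (X ω j : ℝ)) 2 P)
    (hδ : δ = 1 / (6 * A * expSumConst b ^ (d - 1))) (hδs : 1 ≤ δ * s) (θ : Fin d → ℝ) :
    δ ^ 2 / 2 * s ^ 2 * ‖θ‖ ^ 2 ≤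
      ∑ i, ∑ j, θ i * θ j * cov[fun ω => (X ω i : ℝ), fun ω => (X ω j : ℝ); P] := by
  have hs0 : 0 < s := by linarith
  have hC := expSumConst_pos hb
  have hδ0 : 0 < δ := by rw [hδ]; positivity
  set Y : Ω → ℝ := fun ω => ∑ j, θ j * (X ω j : ℝ) with hY
  have hYL : ∀ j, MemLp (fun ω => θ j * (X ω j : ℝ)) 2 P := fun j => (hL j).const_mul _
  have hvar : Var[Y; P] =
      ∑ i, ∑ j, θ i * θ j * cov[fun ω => (X ω i : ℝ), fun ω => (X ω j : ℝ); P] := by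
    rw [hY, variance_fun_sum hYL]
    refine Finset.sum_congr rfl fun i _ => Finset.sum_congr rfl fun j _ => ?_
    rw [covariance_const_mul_left, covariance_const_mul_right]
    ring
  rw [← hvar]
  by_cases hθ : θ = 0
  · rw [hθ, norm_zero]
    simp [variance_nonneg Y P]
  have hne : Nonempty (Fin d) := by
    by_contra hemp
    rw [not_nonempty_iff] at hemp
    exact hθ (Subsingleton.elim _ _)
  -- Slicing along a largest coordinate of `θ` turns `|θ i|` into the sup norm.
  obtain ⟨i, -, hi⟩ := Finset.exists_max_image Finset.univ (fun i => |θ i|) Finset.univ_nonempty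
  have hnorm : ‖θ‖ = |θ i| := by
    refine le_antisymm ?_ (norm_le_pi_norm θ i)
    exact (pi_norm_le_iff_of_nonneg (abs_nonneg (θ i))).2 fun j => hi j (Finset.mem_univ j)
  have hθi : θ i ≠ 0 := by
    intro h0
    rw [h0, abs_zero, norm_eq_zero] at hnorm
    exact hθ hnorm
  have hθi' : 0 < |θ i| := abs_pos.2 hθi
  have hYm : MemLp Y 2 P := memLp_finsetSum _ fun j _ => hYL j
  have h1 := measure_slab_le hX hA hb hs hp hθi (∫ ω, Y ω ∂P) hδs
  -- `δ` is chosen so that the slab of half-width `δ * s * |θ i|` about the mean has probability at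
  -- most one half; Chebyshev's inequality for its complement then bounds the variance below.
  have h2 : 3 * (δ * s) * A * expSumConst b ^ (d - 1) / s = 1 / 2 := by
    rw [hδ]; field_simp; norm_num
  rw [h2] at h1
  have h3 := meas_ge_le_variance_div_sq hYm (c := δ * s * |θ i|) (by positivity)
  have h4 : (1 : ENNReal) ≤ ENNReal.ofReal (1 / 2) +
      ENNReal.ofReal (Var[Y; P] / (δ * s * |θ i|) ^ 2) := by
    rw [← measure_univ (μ := P)]
    refine le_trans ?_ ((measure_union_le _ _).trans (add_le_add h1 h3))
    refine measure_mono fun ω _ => ?_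
    exact lt_or_ge |Y ω - ∫ ω, Y ω ∂P| (δ * s * |θ i|)
  rw [← ENNReal.ofReal_add (by norm_num) (by have := variance_nonneg Y P; positivity),
    ENNReal.one_le_ofReal] at h4
  have h5 : 1 / 2 ≤ Var[Y; P] / (δ * s * |θ i|) ^ 2 := by linarith
  rw [le_div_iff₀ (by positivity)] at h5
  rw [hnorm]
  nlinarith

end Slab

/-! ### From the i.i.d. sum to its summands. -/

section IID

variable {Ω : Type*} [MeasurableSpace Ω] {P : Measure Ω} {d n : ℕ}
  {X : Fin n → Ω → Fin d → ℤ}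

theorem measurable_latticeSum (hX : ∀ i, Measurable (X i)) : Measurable (latticeSum X) :=
  Finset.measurable_fun_sum _ fun i _ => hX i

/-- One way to reach `k + (n - 1) l` is that `X i₀ = k` and every other summand equals `l`. -/
theorem pmf_mul_pow_le [IsProbabilityMeasure P] (hX : ∀ i, Measurable (X i)) (hind : iIndepFun X P)
    (hid : ∀ i j, IdentDistrib (X i) (X j) P P) (i₀ : Fin n) (k l : Fin d → ℤ) :
    pmf P (X i₀) k * pmf P (X i₀) l ^ (n - 1) ≤
      pmf P (latticeSum X) (k + ((n - 1 : ℕ) : ℤ) • l) := by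
  have h1 := hind.measure_inter_preimage_eq_mul Finset.univ
    (sets := fun i => if i = i₀ then {k} else {l}) (fun i _ => by
      split_ifs <;> exact measurableSet_singleton _)
  have h2 : ∏ i, P (X i ⁻¹' (if i = i₀ then {k} else {l})) =
      ENNReal.ofReal (pmf P (X i₀) k * pmf P (X i₀) l ^ (n - 1)) := by
    rw [← Finset.mul_prod_erase _ _ (Finset.mem_univ i₀), if_pos rfl,
      ENNReal.ofReal_mul (pmf_nonneg _), ENNReal.ofReal_pow (pmf_nonneg _), ofReal_pmf (hX i₀),
      ofReal_pmf (hX i₀), Measure.map_apply (hX i₀) (measurableSet_singleton _),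
      Measure.map_apply (hX i₀) (measurableSet_singleton _)]
    congr 1
    rw [Finset.prod_congr rfl (g := fun _ => P (X i₀ ⁻¹' {l})) fun i hi => ?_]
    · rw [Finset.prod_const, Finset.card_erase_of_mem (Finset.mem_univ _), Finset.card_univ,
        Fintype.card_fin]
    · rw [if_neg (Finset.ne_of_mem_erase hi)]
      exact (hid i i₀).measure_mem_eq (measurableSet_singleton _)
  have h3 : P (⋂ i ∈ Finset.univ, X i ⁻¹' (if i = i₀ then {k} else {l})) ≤
      ENNReal.ofReal (pmf P (latticeSum X) (k + ((n - 1 : ℕ) : ℤ) • l)) := by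
    rw [ofReal_pmf (measurable_latticeSum hX),
      Measure.map_apply (measurable_latticeSum hX) (measurableSet_singleton _)]
    refine measure_mono fun ω hω => ?_
    simp only [Finset.mem_univ, Set.iInter_true, Set.mem_iInter, Set.mem_preimage] at hω
    rw [Set.mem_preimage, Set.mem_singleton_iff, latticeSum,
      ← Finset.add_sum_erase _ _ (Finset.mem_univ i₀)]
    have h4 := hω i₀
    rw [if_pos rfl, Set.mem_singleton_iff] at h4
    rw [h4, Finset.sum_congr rfl (g := fun _ => l) fun i hi => ?_]
    · rw [Finset.sum_const, Finset.card_erase_of_mem (Finset.mem_univ _), Finset.card_univ,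
        Fintype.card_fin, natCast_zsmul]
    · have := hω i
      rwa [if_neg (Finset.ne_of_mem_erase hi), Set.mem_singleton_iff] at this
  rw [h1, h2] at h3
  exact (ENNReal.ofReal_le_ofReal_iff (pmf_nonneg _)).1 h3

/-- Exponential decay passes from a sum of i.i.d. vectors to the summands. -/
theorem exists_decay_summand [IsProbabilityMeasure P] (hX : ∀ i, Measurable (X i))
    (hind : iIndepFun X P) (hid : ∀ i j, IdentDistrib (X i) (X j) P P) (i₀ : Fin n) {A b s : ℝ}
    {c : Fin d → ℝ} (hA : 0 < A) (hp : HasDecay A b s c (pmf P (latticeSum X))) :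
    ∃ (A' : ℝ) (c' : Fin d → ℝ), 0 < A' ∧ HasDecay A' b s c' (pmf P (X i₀)) := by
  obtain ⟨l, hl⟩ : ∃ l, 0 < pmf P (X i₀) l := by
    by_contra! hcon
    have h0 : pmf P (X i₀) = 0 := by
      ext k
      exact le_antisymm (hcon k) (pmf_nonneg k)
    have := hasSum_pmf (P := P) (hX i₀)
    rw [h0] at this
    exact zero_ne_one (hasSum_zero.unique this)
  -- The constant depends on the atom at `l` and so is not uniform in the law; it only serves to
  -- obtain finite second moments.
  refine ⟨A / pmf P (X i₀) l ^ (n - 1), fun i => c i - (n - 1 : ℕ) * (l i : ℝ), by positivity,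
    fun k => ?_⟩
  have h1 := (pmf_mul_pow_le hX hind hid i₀ k l).trans (hp _)
  rw [← le_div_iff₀ (by positivity)] at h1
  refine h1.trans_eq ?_
  rw [div_right_comm, mul_div_right_comm, div_right_comm]
  congr 1
  refine Finset.prod_congr rfl fun i _ => ?_
  simp only [Pi.add_apply, Pi.smul_apply, smul_eq_mul]
  push_cast
  congr 4
  ring

theorem covariance_latticeSum [IsProbabilityMeasure P] (hX : ∀ i, Measurable (X i))
    (hind : iIndepFun X P) (hid : ∀ i j, IdentDistrib (X i) (X j) P P) (i₀ : Fin n)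
    (hL : ∀ j, MemLp (fun ω => (X i₀ ω j : ℝ)) 2 P) (i j : Fin d) :
    cov[fun ω => (latticeSum X ω i : ℝ), fun ω => (latticeSum X ω j : ℝ); P] =
      n * cov[fun ω => (X i₀ ω i : ℝ), fun ω => (X i₀ ω j : ℝ); P] := by
  have hcoord : ∀ j : Fin d, Measurable fun k : Fin d → ℤ => (k j : ℝ) := fun j =>
    measurable_of_countable _
  have hLa : ∀ a j, MemLp (fun ω => (X a ω j : ℝ)) 2 P := fun a j =>
    (((hid a i₀).comp (hcoord j)).memLp_iff).2 (hL j)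
  have hsum : ∀ j : Fin d, (fun ω => (latticeSum X ω j : ℝ)) = fun ω => ∑ a, (X a ω j : ℝ) := by
    intro j
    ext ω
    simp [latticeSum, Finset.sum_apply]
  rw [hsum, hsum, covariance_fun_sum_fun_sum (fun a => hLa a i) (fun a => hLa a j)]
  have h1 : ∀ a, ∑ a', cov[fun ω => (X a ω i : ℝ), fun ω => (X a' ω j : ℝ); P] =
      cov[fun ω => (X i₀ ω i : ℝ), fun ω => (X i₀ ω j : ℝ); P] := by
    intro a
    rw [Finset.sum_eq_single a]
    · have h2 : ∀ a, cov[fun ω => (X a ω i : ℝ), fun ω => (X a ω j : ℝ); P] =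
          cov[fun k : Fin d → ℤ => (k i : ℝ), fun k : Fin d → ℤ => (k j : ℝ); P.map (X a)] :=
        fun a => (covariance_map_fun (hcoord i).aestronglyMeasurable
          (hcoord j).aestronglyMeasurable (hX a).aemeasurable).symm
      rw [h2, h2, (hid a i₀).map_eq]
    · intro a' _ hne
      exact ((hind.indepFun hne.symm).comp (hcoord i) (hcoord j)).covariance_eq_zero
        (hLa a i) (hLa a' j)
    · simp
  simp_rw [h1]
  simp

end IID

/-! ### Almost isotropic functions at large scale. -/

section Isotropic

variable {d : ℕ} {f : (Fin d → ℝ) → ℝ} {K : ℝ}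

theorem integral_pos_of_scale_pos (hd : 0 < d) (hf : IsLogConcave f)
    (hs : 0 < scale (covMatrix f)) : 0 < ∫ x, f x := by
  refine (integral_nonneg hf.nonneg).lt_of_ne fun h0 => ?_
  have hd' : (d : ℝ) ≠ 0 := by exact_mod_cast hd.ne'
  have : Nonempty (Fin d) := ⟨⟨0, hd⟩⟩
  -- With integral zero, the convention `x / 0 = 0` makes every covariance entry vanish, hence also
  -- the scale, as `d > 0`.
  have h1 : covMatrix f = 0 := by
    ext i j
    simp [covMatrix, ← h0]
  rw [scale, h1, Matrix.det_zero, Real.zero_rpow (by positivity)] at hs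
  exact lt_irrefl _ hs

/-- The covariance is `s ^ 2` times the identity up to entries of size `K * s`. By Cauchy–Schwarz
the quadratic form changes by at most `K * s * d * ∑ θ i ^ 2`, at most half of the main term when `2
* K * d ≤ s`. -/
theorem IsAlmostIsotropic.isSpread (hd : 0 < d) (hf : IsLogConcave f)
    (hK : IsAlmostIsotropic K f) (hs : 0 < scale (covMatrix f))
    (hsK : 2 * K * d ≤ scale (covMatrix f)) : IsSpread (scale (covMatrix f)) f := by
  have hd' : (1 : ℝ) ≤ d := by exact_mod_cast hd
  set s := scale (covMatrix f) with hsdef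
  have hK0 : 0 ≤ K := by
    have := (abs_nonneg _).trans (hK.diag ⟨0, hd⟩)
    exact nonneg_of_mul_nonneg_left this hs
  refine ⟨hs, hf, hK.integrable, integral_pos_of_scale_pos hd hf hs, fun θ => ?_, fun i => ?_⟩
  · have h1 : ∀ i j, -(K * s * (|θ i| * |θ j|)) ≤
        θ i * θ j * (covMatrix f i j - if i = j then s ^ 2 else 0) := by
      intro i j
      have h2 : |covMatrix f i j - if i = j then s ^ 2 else 0| ≤ K * s := by
        split_ifs with h
        · subst h
          exact hK.diag i
        · simpa using hK.offDiag i j h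
      have h3 : |θ i * θ j * (covMatrix f i j - if i = j then s ^ 2 else 0)| ≤
          K * s * (|θ i| * |θ j|) := by
        rw [abs_mul, abs_mul, mul_comm]
        gcongr
      exact (abs_le.1 h3).1
    have h4 : -(K * s * (∑ i, |θ i|) ^ 2) ≤
        ∑ i, ∑ j, θ i * θ j * covMatrix f i j - s ^ 2 * ∑ i, θ i ^ 2 := by
      have h5 : ∑ i, ∑ j, -(K * s * (|θ i| * |θ j|)) = -(K * s * (∑ i, |θ i|) ^ 2) := by
        rw [sq, Finset.sum_mul_sum, Finset.mul_sum, ← Finset.sum_neg_distrib]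
        refine Finset.sum_congr rfl fun i _ => ?_
        rw [Finset.mul_sum, ← Finset.sum_neg_distrib]
      have h6 : ∑ i, ∑ j, θ i * θ j * (covMatrix f i j - if i = j then s ^ 2 else 0) =
          ∑ i, ∑ j, θ i * θ j * covMatrix f i j - s ^ 2 * ∑ i, θ i ^ 2 := by
        rw [Finset.mul_sum, ← Finset.sum_sub_distrib]
        refine Finset.sum_congr rfl fun i _ => ?_
        simp only [mul_sub, Finset.sum_sub_distrib, mul_ite, mul_zero, Finset.sum_ite_eq,
          Finset.mem_univ, if_true]
        ring
      rw [← h5, ← h6]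
      exact Finset.sum_le_sum fun i _ => Finset.sum_le_sum fun j _ => h1 i j
    have h7 : (∑ i, |θ i|) ^ 2 ≤ d * ∑ i, θ i ^ 2 := by
      have := sq_sum_le_card_mul_sum_sq (s := Finset.univ) (f := fun i => |θ i|)
      simpa [sq_abs] using this
    have h8 : 0 ≤ ∑ i, θ i ^ 2 := Finset.sum_nonneg fun i _ => sq_nonneg _
    have h9 : K * s * (∑ i, |θ i|) ^ 2 ≤ s ^ 2 / 2 * ∑ i, θ i ^ 2 := by
      calc K * s * (∑ i, |θ i|) ^ 2 ≤ K * s * (d * ∑ i, θ i ^ 2) := by gcongr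
        _ = (K * d) * s * ∑ i, θ i ^ 2 := by ring
        _ ≤ (s / 2) * s * ∑ i, θ i ^ 2 := by gcongr; linarith
        _ = _ := by ring
    linarith
  · have h1 := (abs_le.1 (hK.diag i)).2
    have h2 : K ≤ s := by nlinarith
    nlinarith

end Isotropic

/-! ### The entropy gap and the scale of the summands. -/

section Main

variable {Ω : Type*} [MeasurableSpace Ω] {P : Measure Ω} [IsProbabilityMeasure P] {d n : ℕ}
  {X : Fin n → Ω → Fin d → ℤ} {U : Fin n → Ω → Fin d → ℝ}

theorem HasDecay.le {A b s : ℝ} (hA : 0 < A) (hb : 0 < b) (hs : 0 < s) {c : Fin d → ℝ}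
    {p : (Fin d → ℤ) → ℝ} (hp : HasDecay A b s c p) (k : Fin d → ℤ) : p k ≤ A / s ^ d := by
  refine (hp k).trans (mul_le_of_le_one_right (by positivity) ?_)
  refine Finset.prod_le_one (fun i _ => (Real.exp_pos _).le) fun i _ => ?_
  rw [Real.exp_le_one_iff, neg_nonpos]
  positivity

/-- The differential entropy of the smoothed sum exceeds the Shannon entropy of the sum by at most
the order of the variation of its mass function. -/
theorem differentialEntropy_smoothedSum (hn : 0 < n) (hX : ∀ i, Measurable (X i))
    (hU : ∀ i, Measurable (U i)) (hUi : iIndepFun U P)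
    (hUu : ∀ i, pdf.IsUniform (U i) (Set.Icc 0 1) P volume)
    (hXU : IndepFun (fun ω i => X i ω) (fun ω i => U i ω) P)
    (hH : HasShannonEntropy P (latticeSum X)) {τ : ℝ} (hτ0 : 0 ≤ τ)
    (hT : ∀ i, shiftVariation (pmf P (latticeSum X)) (Pi.single i 1) ≤ ENNReal.ofReal τ) :
    HasDifferentialEntropy P (smoothedSum X U) ∧
      |differentialEntropy P (smoothedSum X U) - shannonEntropy P (latticeSum X)| ≤
        2 * ((n + 1) ^ d) ^ 2 * d * n * τ := by
  have hWm : Measurable fun ω => ∑ i ∈ Finset.univ.erase (⟨0, hn⟩ : Fin n), U i ω :=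
    Finset.measurable_fun_sum _ fun i _ => hU i
  have hmap := map_smoothedSum hn hX hU hUi hUu hXU
  have hν := ae_sum_uniform hn hU hUu
  set ν := P.map fun ω => ∑ i ∈ Finset.univ.erase (⟨0, hn⟩ : Fin n), U i ω
  have : IsProbabilityMeasure ν := Measure.isProbabilityMeasure_map hWm.aemeasurable
  obtain ⟨h1, h2, h3⟩ := entropy_smoothing (n := n) (pmf_nonneg (P := P) (X := latticeSum X))
    (pmf_le_one (measurable_latticeSum hX)) hH hτ0 hT (measurable_cubeConv ν)
    (lintegral_cubeConv ν) (tsum_cubeConv ν) fun x hx => cubeConv_support hν hx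
  set g : (Fin d → ℝ) → ENNReal :=
    fun x => ∑' k, ENNReal.ofReal (pmf P (latticeSum X) k) * cubeConv ν (x - castVec k) with hg
  have hgm : Measurable g := Measurable.tsum fun k =>
    ((measurable_cubeConv ν).comp (measurable_id.sub_const _)).const_mul _
  have hYm : Measurable (smoothedSum X U) := by
    refine measurable_pi_lambda _ fun j => ?_
    refine Measurable.add ?_ (Finset.measurable_fun_sum _ fun i _ =>
      (measurable_pi_apply j).comp (hU i))
    exact (measurable_of_countable fun k : Fin d → ℤ => (k j : ℝ)).comp (measurable_latticeSum hX)
  have hpdf : HasPDF (smoothedSum X U) P volume :=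
    hasPDF_of_map_eq_withDensity hYm.aemeasurable g hgm.aemeasurable hmap
  have hae : pdf (smoothedSum X U) P volume =ᵐ[volume] g :=
    (pdf.eq_of_map_eq_withDensity g hgm.aemeasurable).1 hmap
  have hae' : (fun x => Real.negMulLog (pdf (smoothedSum X U) P volume x).toReal) =ᵐ[volume]
      fun x => Real.negMulLog (g x).toReal := by
    filter_upwards [hae] with x hx
    rw [hx]
  refine ⟨⟨hpdf, h1.congr hae'.symm⟩, ?_⟩
  rw [differentialEntropy, integral_congr_ae hae', shannonEntropy, abs_of_nonneg (by linarith)]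
  linarith

/-- When all summands equal `k` the sum is `n k`, so `P(X = k) ^ n` is at most an atom of the sum.
-/
theorem pmf_summand_le (hn : 0 < n) (hX : ∀ i, Measurable (X i)) (hind : iIndepFun X P)
    (hid : ∀ i j, IdentDistrib (X i) (X j) P P) (i₀ : Fin n) {M : ℝ}
    (hM : ∀ k, pmf P (latticeSum X) k ≤ Real.exp (-M) ^ n) (k : Fin d → ℤ) :
    pmf P (X i₀) k ≤ Real.exp (-M) := by
  have h1 := (pmf_mul_pow_le hX hind hid i₀ k k).trans (hM _)
  rw [mul_pow_sub_one hn.ne'] at h1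
  exact (pow_le_pow_iff_left₀ (pmf_nonneg k) (Real.exp_pos _).le hn.ne').1 h1

/-- The covariance matrix of the summands is of the order of `s ^ 2` if the mass function of the sum
decays on the scale `s`. -/
theorem scale_discreteCovMatrix_bounds (hd : 0 < d) (hn : 0 < n) (hX : ∀ i, Measurable (X i))
    (hind : iIndepFun X P) (hid : ∀ i j, IdentDistrib (X i) (X j) P P) (i₀ : Fin n)
    {A b s δ V : ℝ} (hA : 0 < A) (hb : 0 < b) (hs1 : 1 ≤ s) {c : Fin d → ℝ}
    (hp : HasDecay A b s c (pmf P (latticeSum X)))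
    (hLX : ∀ j, MemLp (fun ω => (X i₀ ω j : ℝ)) 2 P)
    (hVX : ∀ j, Var[fun ω => (X i₀ ω j : ℝ); P] ≤ V * s ^ 2) (hV0 : 0 ≤ V)
    (hδ : δ = 1 / (6 * A * expSumConst b ^ (d - 1))) (hδs : 1 ≤ δ * s) :
    δ / (2 * n * d) * s ≤ scale (discreteCovMatrix (pmf P (X i₀))) ∧
      scale (discreteCovMatrix (pmf P (X i₀))) ≤ (d * V + 1) * s := by
  have hd' : (1 : ℝ) ≤ d := by exact_mod_cast hd
  have hn' : (1 : ℝ) ≤ n := by exact_mod_cast hn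
  have hs0 : 0 < s := by linarith
  have hδ0 : 0 < δ := by
    have := expSumConst_pos hb
    rw [hδ]
    positivity
  have hSm := measurable_latticeSum hX
  have hLS := fun j => (memLp_and_variance_le_of_decay hSm hA hb hs1 hp j).1
  have hcov := covariance_latticeSum hX hind hid i₀ hLX
  set B := discreteCovMatrix (pmf P (X i₀)) with hB
  have hBij : ∀ i j, B i j = cov[fun ω => (X i₀ ω i : ℝ), fun ω => (X i₀ ω j : ℝ); P] :=
    discreteCovMatrix_pmf (hX i₀) hLX
  have hBH : B.IsHermitian := by
    ext i j
    rw [Matrix.conjTranspose_apply, star_trivial, hBij, hBij, covariance_comm]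
  obtain ⟨hlo, hhi⟩ := det_bounds hBH (L := δ ^ 2 / (2 * n) * s ^ 2) (V := V * s ^ 2)
    (by positivity) (fun θ => by
      have h1 := le_covariance_of_decay hSm hA hb hs1 hp hLS hδ hδs θ
      have h2 : ∑ i, ∑ j, θ i * θ j * cov[fun ω => (latticeSum X ω i : ℝ),
          fun ω => (latticeSum X ω j : ℝ); P] = n * ∑ i, ∑ j, θ i * θ j * B i j := by
        simp_rw [hcov, hBij, Finset.mul_sum]
        exact Finset.sum_congr rfl fun i _ => Finset.sum_congr rfl fun j _ => by ring
      rw [h2] at h1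
      have h3 : δ ^ 2 / 2 * s ^ 2 * ‖θ‖ ^ 2 = n * (δ ^ 2 / (2 * n) * s ^ 2 * ‖θ‖ ^ 2) := by
        field_simp
      rw [h3] at h1
      exact le_of_mul_le_mul_left h1 (by positivity))
    (fun i => by
      rw [hBij, covariance_self (hLX i).aemeasurable]
      exact hVX i)
  constructor
  · refine le_scale_of_pow_le_det hd (by positivity) (le_trans ?_ hlo)
    refine pow_le_pow_left₀ (by positivity) ?_ d
    have h1 : (δ / (2 * n * d) * s) ^ 2 = δ ^ 2 / (2 * n) * s ^ 2 / d * (1 / (2 * n * d)) := by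
      field_simp
    rw [h1]
    refine mul_le_of_le_one_right (by positivity) ?_
    rw [div_le_one (by positivity)]
    nlinarith
  · refine scale_le_of_det_le_pow hd (by positivity) (le_trans (by positivity) hlo)
      (hhi.trans ?_)
    refine pow_le_pow_left₀ (by positivity) ?_ d
    have hdV : 0 ≤ d * V := by positivity
    have : d * V ≤ (d * V + 1) ^ 2 := by nlinarith
    rw [mul_pow, ← mul_assoc]
    exact mul_le_mul_of_nonneg_right this (sq_nonneg s)

end Main

end DiscreteEntropy

/-! ### The main theorem. -/

open DiscreteEntropy in
theorem mainTheorem2 (d n : ℕ) (hd : 0 < d) (hn : 0 < n) :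
    ∃ C : ℝ, 0 < C ∧ ∀ K : ℝ, ∃ N : ℝ,
      ∀ (Ω : Type*) [MeasurableSpace Ω] (P : Measure Ω) [IsProbabilityMeasure P]
        (X : Fin n → Ω → Fin d → ℤ) (U : Fin n → Ω → Fin d → ℝ) (f : (Fin d → ℝ) → ℝ),
        (∀ i, Measurable (X i)) → (∀ i, Measurable (U i)) →
        -- `X₁, …, Xₙ` are i.i.d.
        iIndepFun X P → (∀ i j, IdentDistrib (X i) (X j) P P) →
        -- `U₁, …, Uₙ` are i.i.d. uniform on `[0,1]^d`, and independent of `X₁, …, Xₙ`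
        iIndepFun U P → (∀ i, pdf.IsUniform (U i) (Set.Icc 0 1) P volume) →
        IndepFun (fun ω i => X i ω) (fun ω i => U i ω) P →
        -- `f` is an almost isotropic log-concave extension of the p.m.f. of `X₁ + ⋯ + Xₙ`
        IsLogConcaveExtension (pmf P (latticeSum X)) f →
        IsAlmostIsotropic K f → N ≤ scale (covMatrix f) →
        -- all the entropies are well defined and finite
        HasShannonEntropy P (X ⟨0, hn⟩) ∧ HasShannonEntropy P (latticeSum X) ∧
        HasDifferentialEntropy P (smoothedSum X U) ∧
        -- the rate in terms of `H(X₁)`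
        |differentialEntropy P (smoothedSum X U) - shannonEntropy P (latticeSum X)| ≤
          C * (shannonEntropy P (X ⟨0, hn⟩) * Real.exp (-shannonEntropy P (X ⟨0, hn⟩) / d)) ∧
        -- the rate `log σ / σ` in terms of `σ = det(Cov(X₁))^(1/(2d))`
        |differentialEntropy P (smoothedSum X U) - shannonEntropy P (latticeSum X)| ≤
          C * (Real.log (scale (discreteCovMatrix (pmf P (X ⟨0, hn⟩)))) /
            scale (discreteCovMatrix (pmf P (X ⟨0, hn⟩)))) := by
  have hd' : (1 : ℝ) ≤ d := by exact_mod_cast hd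
  have hn' : (1 : ℝ) ≤ n := by exact_mod_cast hn
  obtain ⟨A, b, s₀, hA, hb, hs₀, hdecay⟩ := IsSpread.exists_decay hd
  have hCb := expSumConst_pos hb
  have hCb2 := expSumConst_pos (b := b / 2) (by positivity)
  have hC1 := expSumConst_pos one_pos
  set V : ℝ := 8 * A * expSumConst (b / 2) ^ d / b ^ 2 with hV
  have hV0 : 0 < V := by positivity
  set δ : ℝ := 1 / (6 * A * expSumConst b ^ (d - 1)) with hδ
  have hδ0 : 0 < δ := by positivity
  set G : ℝ := 2 * ((n + 1) ^ d) ^ 2 * d * n * (4 * A * expSumConst b ^ (d - 1)) with hG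
  have hG0 : 0 < G := by positivity
  set D : ℝ := d + d * V + expSumConst 1 ^ d with hD
  set l : ℝ := δ / (2 * n * d) with hl
  have hl0 : 0 < l := by positivity
  set u : ℝ := d * V + 1 with hu
  have hu0 : 0 < u := by positivity
  -- The two terms of `C` serve the two rates. The terms of `N` ensure in turn `1 ≤ s`, the decay
  -- estimate, `1 ≤ δ * s`, `σ ≥ l * s ≥ 3`, atoms of `X₁` at most `exp (-1)`, and spreading; the
  -- absolute value allows for negative `K`.
  refine ⟨G * Real.exp (D / d) + G * u, by positivity, fun K =>
    ⟨1 + s₀ + 1 / δ + 3 / l + A * Real.exp 1 ^ n + |2 * K * d|, ?_⟩⟩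
  intro Ω _ P _ X U f hX hU hind hid hUi hUu hXU hf hK hN
  set s := scale (covMatrix f) with hs
  set i₀ : Fin n := ⟨0, hn⟩ with hi₀
  have e1 : 0 < 1 / δ := by positivity
  have e2 : 0 < 3 / l := by positivity
  have e3 : 0 < A * Real.exp 1 ^ n := by positivity
  have e4 := abs_nonneg (2 * K * d)
  have hs1 : 1 ≤ s := by linarith
  have hs0 : 0 < s := by linarith
  have hSm := measurable_latticeSum hX
  have hspread : IsSpread s f := hK.isSpread hd hf.1 hs0 (by
    linarith [le_abs_self (2 * K * d)])
  obtain ⟨c, hc⟩ := hdecay s f hspread (by linarith) fun F => by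
    simp_rw [hf.2]
    exact sum_le_hasSum F (fun k _ => pmf_nonneg k) (hasSum_pmf hSm)
  have hp : HasDecay A b s c (pmf P (latticeSum X)) := fun k => by
    rw [← hf.2]
    exact hc _
  have hLS := fun j => (memLp_and_variance_le_of_decay hSm hA hb hs1 hp j).1
  have hVS := fun j => (memLp_and_variance_le_of_decay hSm hA hb hs1 hp j).2
  obtain ⟨A', c', hA', hq⟩ := exists_decay_summand hX hind hid i₀ hA hp
  have hLX := fun j => (memLp_and_variance_le_of_decay (hX i₀) hA' hb hs1 hq j).1
  have hcov := covariance_latticeSum hX hind hid i₀ hLX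
  -- The uniform bound comes from `Var S_n = n Var X₁`, not from the decay of `X₁`, whose constant
  -- `A'` is uncontrolled.
  have hVX : ∀ j, Var[fun ω => (X i₀ ω j : ℝ); P] ≤ V * s ^ 2 := by
    intro j
    have h1 := hcov j j
    rw [covariance_self (hLS j).aemeasurable, covariance_self (hLX j).aemeasurable] at h1
    have h2 := variance_nonneg (fun ω => (X i₀ ω j : ℝ)) P
    nlinarith [hVS j]
  have hHS := (entropy_le hSm hs1 hLS hVS).1
  obtain ⟨hHX, hHXle⟩ := entropy_le (hX i₀) hs1 hLX hVX
  have hHX1 : 1 ≤ shannonEntropy P (X i₀) := by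
    refine one_le_entropy (hX i₀) hHX (pmf_summand_le hn hX hind hid i₀ fun k => ?_)
    refine (hp.le hA hb hs0 k).trans ?_
    have h1 : A * Real.exp 1 ^ n ≤ s ^ d := by
      have : s ≤ s ^ d := le_self_pow₀ hs1 hd.ne'
      linarith
    rw [div_le_iff₀ (by positivity), Real.exp_neg, inv_pow, inv_mul_eq_div,
      le_div_iff₀ (by positivity)]
    exact h1
  obtain ⟨hdiff, hgap⟩ := differentialEntropy_smoothedSum hn hX hU hUi hUu hXU hHS
    (τ := 4 * A * expSumConst b ^ (d - 1) / s) (by positivity)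
    fun i => shiftVariation_single_le hA hb hs1 hf hp i
  have hgap' : |differentialEntropy P (smoothedSum X U) - shannonEntropy P (latticeSum X)| ≤
      G / s := by
    refine hgap.trans_eq ?_
    rw [hG]
    ring
  refine ⟨hHX, hHS, hdiff, hgap'.trans ?_, hgap'.trans ?_⟩
  · have h1 : Real.exp (-(D / d)) / s ≤ Real.exp (-shannonEntropy P (X i₀) / d) := by
      rw [div_eq_mul_inv, ← Real.exp_log hs0, ← Real.exp_neg, ← Real.exp_add, Real.exp_le_exp,
        le_div_iff₀ (by positivity)]
      have : (-(D / d) + -Real.log s) * d = -(d * Real.log s + D) := by field_simp; ring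
      rw [this]
      linarith
    calc G / s = G * Real.exp (D / d) * (1 * (Real.exp (-(D / d)) / s)) := by
          rw [Real.exp_neg]; field_simp
      _ ≤ (G * Real.exp (D / d) + G * u) * (1 * (Real.exp (-(D / d)) / s)) := by
          gcongr
          have : 0 < G * u := by positivity
          linarith
      _ ≤ _ := by gcongr
  · set B := discreteCovMatrix (pmf P (X i₀)) with hB
    obtain ⟨hscale_lo, hscale_hi⟩ := scale_discreteCovMatrix_bounds hd hn hX hind hid i₀ hA hb hs1 hp
      hLX hVX hV0.le hδ (by rw [← div_le_iff₀' hδ0]; linarith)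
    have hscale3 : 3 ≤ scale B := by
      refine le_trans ?_ hscale_lo
      rw [← div_le_iff₀' hl0]
      linarith
    have hlog : 1 ≤ Real.log (scale B) := by
      rw [Real.le_log_iff_exp_le (by linarith)]
      linarith [Real.exp_one_lt_d9]
    calc G / s = G * u * (1 / (u * s)) := by field_simp
      _ ≤ (G * Real.exp (D / d) + G * u) * (1 / (u * s)) := by
          gcongr
          have : 0 < G * Real.exp (D / d) := by positivity
          linarith
      _ ≤ _ := by
          gcongr
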